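/- **Setting.** A memoryless 3-user cognitive interference channel with cumulative message sharing has input alphabets $\mathcal X_1,\mathcal X_2,\mathcal X_3$ and output alphabets $\mathcal Y_1,\mathcal Y_2,\mathcal Y_3$ (non-empty standard Borel spaces, e.g. finite sets or $\mathbb R^d$) and a transition probability $W=P_{Y_1,Y_2,Y_3|X_1,X_2,X_3}$. A code of block length $N$ and rates $R_1,R_2,R_3\ge 0$ consists of independent messages $W_i$, uniform on $\{1,\dots,\lfloor 2^{NR_i}\rfloor\}$, encoding functions $X_1^N=f_1(W_1)$, $X_2^N=f_2(W_1,W_2)$, $X_3^N=f_3(W_1,W_2,W_3)$, and (measurable) decoding functions $\widehat W_i=g_i(Y_i^N)$, where the $N$ input letters pass independently through $W$, without feedback. Its error probability is $\max_i\mathbb P[\widehat W_i\ne W_i]$. The capacity region $\mathcal C(W)$ is the set of $(R_1,R_2,R_3)$ with $R_i\ge 0$ for which there is a sequence of codes, one for each $N$, whose error probability tends to $0$ as $N\to\infty$. Let $\mathcal O(W)$ be the set of $(R_1,R_2,R_3)\in\mathbb R^3$ for which there is an input distribution $P_{X_1,X_2,X_3}$ such that, for every joint conditional distribution $V=P_{Y_1,Y_2,Y_3|X_1,X_2,X_3}$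 with the same conditional marginals $P_{Y_i|X_1,X_2,X_3}$, $i=1,2,3$, as $W$, $$ \begin{aligned} R_1&\le I(Y_1;X_1,X_2,X_3),\\ R_2&\le I(Y_2;X_2,X_3\mid X_1),\\ R_3&\le I(Y_3;X_3\mid X_1,X_2),\\ R_2+R_3&\le I(Y_2;X_2,X_3\mid X_1)+I(Y_3;X_3\mid X_1,X_2,Y_2),\\ R_1+R_2+R_3&\le I(Y_1;X_1,X_2,X_3)+I(Y_2;X_2,X_3\mid X_1,Y_1)+I(Y_3;X_3\mid X_1,Y_1,X_2,Y_2), \end{aligned} $$ where the (conditional) mutual informations, in bits and with values in $[0,\infty]$, are taken under $P_{X_1,X_2,X_3}\,V$. **Theorem.** (i) $\mathcal C(W)\subseteq\overline{\mathcal O(W)}$ (closure in $\mathbb R^3$). (ii) If $\mathcal X_1,\mathcal X_2,\mathcal X_3$ are finite, then $\mathcal C(W)\subseteq\mathcal O(W)$. (iii) The bound reduces to the two-user bound of Rini et al. when $X_3$ and $Y_3$ are removed: if $W_2=P_{Y_1,Y_2|X_1,X_2}$ is a two-user channel and $W_2^+$ is the three-user channel obtained from it by adding one-point alphabets $\mathcal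 X_3,\mathcal Y_3$, then $(R_1,R_2,0)\in\mathcal O(W_2^+)$ if and only if there is an input distribution $P_{X_1,X_2}$ such that, for every joint conditional distribution of $(Y_1,Y_2)$ given $(X_1,X_2)$ with the same conditional marginals as $W_2$, $R_1\le I(Y_1;X_1,X_2)$, $R_2\le I(Y_2;X_2\mid X_1)$ and $R_1+R_2\le I(Y_1;X_1,X_2)+I(Y_2;X_2\mid X_1,Y_1)$. -/

import Mathlib

open MeasureTheory ProbabilityTheory InformationTheory Filter Topology
open scoped ENNReal

noncomputable section

namespace CIFC

/-- Mutual information `I(A;B)` in bits, for random variables `A`, `B` on `(Ω, μ)`: the divergence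
of the joint law from the product of the marginal laws. -/
def mutualInfo {Ω α β : Type*} [MeasurableSpace Ω] [MeasurableSpace α] [MeasurableSpace β]
    (μ : Measure Ω) (A : Ω → α) (B : Ω → β) : ℝ≥0∞ :=
  klDiv (μ.map fun ω => (A ω, B ω)) ((μ.map A).prod (μ.map B)) / ENNReal.ofReal (Real.log 2)

/-- Conditional mutual information `I(A;B|C)` in bits: the divergence of the law of `(C, A, B)`
from `P_C ⊗ (P_{A|C} × P_{B|C})`, the law under which `A` and `B` are independent given `C`. -/
def condMutualInfo {Ω α β γ : Type*} [MeasurableSpace Ω] [MeasurableSpace α]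
    [StandardBorelSpace α] [Nonempty α] [MeasurableSpace β] [StandardBorelSpace β] [Nonempty β]
    [MeasurableSpace γ] (μ : Measure Ω) [IsFiniteMeasure μ]
    (A : Ω → α) (B : Ω → β) (C : Ω → γ) : ℝ≥0∞ :=
  klDiv (μ.map fun ω => (C ω, A ω, B ω))
    ((μ.map C) ⊗ₘ (condDistrib A C μ ×ₖ condDistrib B C μ)) / ENNReal.ofReal (Real.log 2)

/-- A block code of length `N` with `M₁`, `M₂`, `M₃` messages and cumulative message sharing:
transmitter `i` knows the messages of users `1, …, i`, receiver `i` sees only its own output. -/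
structure Code (X₁ X₂ X₃ Y₁ Y₂ Y₃ : Type*) [MeasurableSpace Y₁] [MeasurableSpace Y₂]
    [MeasurableSpace Y₃] (N M₁ M₂ M₃ : ℕ) where
  enc₁ : Fin M₁ → Fin N → X₁
  enc₂ : Fin M₁ → Fin M₂ → Fin N → X₂
  enc₃ : Fin M₁ → Fin M₂ → Fin M₃ → Fin N → X₃
  dec₁ : (Fin N → Y₁) → Fin M₁
  dec₂ : (Fin N → Y₂) → Fin M₂
  dec₃ : (Fin N → Y₃) → Fin M₃
  measurable_dec₁ : Measurable dec₁
  measurable_dec₂ : Measurable dec₂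
  measurable_dec₃ : Measurable dec₃

section ThreeUser

variable {X₁ X₂ X₃ Y₁ Y₂ Y₃ : Type*}
  [MeasurableSpace X₁] [MeasurableSpace X₂] [MeasurableSpace X₃]
  [MeasurableSpace Y₁] [MeasurableSpace Y₂] [MeasurableSpace Y₃]

/-- The joint law of the messages `(w₁, w₂, w₃)` and of the block of channel outputs, when the
messages are independent and uniform and each letter of the block passes independently through the
channel `W` (memoryless, without feedback). -/
def Code.law {N M₁ M₂ M₃ : ℕ} (c : Code X₁ X₂ X₃ Y₁ Y₂ Y₃ N M₁ M₂ M₃)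
    (W : Kernel (X₁ × X₂ × X₃) (Y₁ × Y₂ × Y₃)) :
    Measure ((Fin M₁ × Fin M₂ × Fin M₃) × (Fin N → Y₁ × Y₂ × Y₃)) :=
  (uniformOn (Set.univ : Set (Fin M₁ × Fin M₂ × Fin M₃))) ⊗ₘ
    (Kernel.ofFunOfCountable fun w : Fin M₁ × Fin M₂ × Fin M₃ =>
      Measure.pi fun t : Fin N =>
        W (c.enc₁ w.1 t, c.enc₂ w.1 w.2.1 t, c.enc₃ w.1 w.2.1 w.2.2 t))

/-- The largest of the three probabilities that receiver `i` decodes its message wrongly. -/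
def Code.errorProb {N M₁ M₂ M₃ : ℕ} (c : Code X₁ X₂ X₃ Y₁ Y₂ Y₃ N M₁ M₂ M₃)
    (W : Kernel (X₁ × X₂ × X₃) (Y₁ × Y₂ × Y₃)) : ℝ≥0∞ :=
  max (c.law W {p | c.dec₁ (fun t => (p.2 t).1) ≠ p.1.1})
    (max (c.law W {p | c.dec₂ (fun t => (p.2 t).2.1) ≠ p.1.2.1})
      (c.law W {p | c.dec₃ (fun t => (p.2 t).2.2) ≠ p.1.2.2}))

/-- The capacity region: non-negative rate triples for which some sequence of codes, the `N`-th of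
block length `N` with message sets `{1, …, ⌊2^{N Rᵢ}⌋}`, has vanishing error probability. -/
def capacityRegion (W : Kernel (X₁ × X₂ × X₃) (Y₁ × Y₂ × Y₃)) : Set (ℝ × ℝ × ℝ) :=
  {R | 0 ≤ R.1 ∧ 0 ≤ R.2.1 ∧ 0 ≤ R.2.2 ∧
    ∃ c : ∀ N : ℕ, Code X₁ X₂ X₃ Y₁ Y₂ Y₃ N
        ⌊(2 : ℝ) ^ ((N : ℝ) * R.1)⌋₊ ⌊(2 : ℝ) ^ ((N : ℝ) * R.2.1)⌋₊
        ⌊(2 : ℝ) ^ ((N : ℝ) * R.2.2)⌋₊,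
      Tendsto (fun N => (c N).errorProb W) atTop (𝓝 0)}

/-- The two channels have the same conditional law of each single output `Yᵢ` given all inputs. -/
def SameMarginals (W V : Kernel (X₁ × X₂ × X₃) (Y₁ × Y₂ × Y₃)) : Prop :=
  V.fst = W.fst ∧ V.snd.fst = W.snd.fst ∧ V.snd.snd = W.snd.snd

end ThreeUser

section Bounds

variable {X₁ X₂ X₃ Y₁ Y₂ Y₃ : Type*}
  [MeasurableSpace X₁] [StandardBorelSpace X₁] [Nonempty X₁]
  [MeasurableSpace X₂] [StandardBorelSpace X₂] [Nonempty X₂]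
  [MeasurableSpace X₃] [StandardBorelSpace X₃] [Nonempty X₃]
  [MeasurableSpace Y₁] [StandardBorelSpace Y₁] [Nonempty Y₁]
  [MeasurableSpace Y₂] [StandardBorelSpace Y₂] [Nonempty Y₂]
  [MeasurableSpace Y₃] [StandardBorelSpace Y₃] [Nonempty Y₃]

/-- The five rate bounds, for the input law `P` and the channel `V`; the random variables are the
coordinates `((x₁, x₂, x₃), (y₁, y₂, y₃))` under the law `P ⊗ V`. -/
structure RateBounds (P : Measure (X₁ × X₂ × X₃)) [IsProbabilityMeasure P]
    (V : Kernel (X₁ × X₂ × X₃) (Y₁ × Y₂ × Y₃)) [IsMarkovKernel V] (R : ℝ × ℝ × ℝ) : Prop where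
  /-- `R₁ ≤ I(Y₁; X₁, X₂, X₃)` -/
  rate₁ : ENNReal.ofReal R.1 ≤ mutualInfo (P ⊗ₘ V) (fun ω => ω.2.1) (fun ω => ω.1)
  /-- `R₂ ≤ I(Y₂; X₂, X₃ | X₁)` -/
  rate₂ : ENNReal.ofReal R.2.1 ≤
    condMutualInfo (P ⊗ₘ V) (fun ω => ω.2.2.1) (fun ω => ω.1.2) (fun ω => ω.1.1)
  /-- `R₃ ≤ I(Y₃; X₃ | X₁, X₂)` -/
  rate₃ : ENNReal.ofReal R.2.2 ≤
    condMutualInfo (P ⊗ₘ V) (fun ω => ω.2.2.2) (fun ω => ω.1.2.2) (fun ω => (ω.1.1, ω.1.2.1))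
  /-- `R₂ + R₃ ≤ I(Y₂; X₂, X₃ | X₁) + I(Y₃; X₃ | X₁, X₂, Y₂)` -/
  rate₂₃ : ENNReal.ofReal (R.2.1 + R.2.2) ≤
    condMutualInfo (P ⊗ₘ V) (fun ω => ω.2.2.1) (fun ω => ω.1.2) (fun ω => ω.1.1) +
    condMutualInfo (P ⊗ₘ V) (fun ω => ω.2.2.2) (fun ω => ω.1.2.2)
      (fun ω => (ω.1.1, ω.1.2.1, ω.2.2.1))
  /-- `R₁ + R₂ + R₃ ≤ I(Y₁; X₁, X₂, X₃) + I(Y₂; X₂, X₃ | X₁, Y₁) + I(Y₃; X₃ | X₁, Y₁, X₂, Y₂)` -/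
  rate₁₂₃ : ENNReal.ofReal (R.1 + R.2.1 + R.2.2) ≤
    mutualInfo (P ⊗ₘ V) (fun ω => ω.2.1) (fun ω => ω.1) +
    condMutualInfo (P ⊗ₘ V) (fun ω => ω.2.2.1) (fun ω => ω.1.2) (fun ω => (ω.1.1, ω.2.1)) +
    condMutualInfo (P ⊗ₘ V) (fun ω => ω.2.2.2) (fun ω => ω.1.2.2)
      (fun ω => (ω.1.1, ω.2.1, ω.1.2.1, ω.2.2.1))

/-- Rate triples that satisfy the five bounds for some input law `P` and, with this same `P`, for
every choice of the joint channel law with the conditional marginals of `W`. -/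
def outerRegion (W : Kernel (X₁ × X₂ × X₃) (Y₁ × Y₂ × Y₃)) : Set (ℝ × ℝ × ℝ) :=
  {R | ∃ (P : Measure (X₁ × X₂ × X₃)) (_ : IsProbabilityMeasure P),
    ∀ (V : Kernel (X₁ × X₂ × X₃) (Y₁ × Y₂ × Y₃)) (_ : IsMarkovKernel V),
      SameMarginals W V → RateBounds P V R}

/-- The two-user bounds of Rini et al., user 1 being the primary user:
`R₁ ≤ I(Y₁; X₁, X₂)`, `R₂ ≤ I(Y₂; X₂ | X₁)`, `R₁ + R₂ ≤ I(Y₁; X₁, X₂) + I(Y₂; X₂ | X₁, Y₁)`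
for some input law and every joint channel law with the conditional marginals of `W`. -/
def twoUserOuterRegion (W : Kernel (X₁ × X₂) (Y₁ × Y₂)) : Set (ℝ × ℝ) :=
  {R | ∃ (P : Measure (X₁ × X₂)) (_ : IsProbabilityMeasure P),
    ∀ (V : Kernel (X₁ × X₂) (Y₁ × Y₂)) (_ : IsMarkovKernel V),
      V.fst = W.fst → V.snd = W.snd →
        ENNReal.ofReal R.1 ≤ mutualInfo (P ⊗ₘ V) (fun ω => ω.2.1) (fun ω => ω.1) ∧
        ENNReal.ofReal R.2 ≤
          condMutualInfo (P ⊗ₘ V) (fun ω => ω.2.2) (fun ω => ω.1.2) (fun ω => ω.1.1) ∧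
        ENNReal.ofReal (R.1 + R.2) ≤
          mutualInfo (P ⊗ₘ V) (fun ω => ω.2.1) (fun ω => ω.1) +
          condMutualInfo (P ⊗ₘ V) (fun ω => ω.2.2) (fun ω => ω.1.2) (fun ω => (ω.1.1, ω.2.1))}

end Bounds

/-- A two-user channel regarded as a three-user channel whose third user has one-point alphabets. -/
def addTrivialUser {X₁ X₂ Y₁ Y₂ : Type*} [MeasurableSpace X₁] [MeasurableSpace X₂]
    [MeasurableSpace Y₁] [MeasurableSpace Y₂] (W : Kernel (X₁ × X₂) (Y₁ × Y₂)) :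
    Kernel (X₁ × X₂ × Unit) (Y₁ × Y₂ × Unit) :=
  (W.comap (fun x : X₁ × X₂ × Unit => (x.1, x.2.1)) (by fun_prop)).map
    (fun y : Y₁ × Y₂ => (y.1, y.2, ()))

end CIFC

end

/-!
The bounds come from a change of measure. If under a test channel `Q` the outputs of the receivers
do not depend on what they should reveal, correct decoding under `Q` is no better than guessing one
of `K` equally likely messages. By the data processing inequality, a code that succeeds under `V`
then satisfies `log K ≲ D(V-law ‖ Q-law)`, and over a block this divergence is `N` times the
divergence `D(P ⊗ V ‖ P ⊗ Q)` of the single-letter laws, where `P` is the law of the channel input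
at a uniformly chosen time. By the chain rule, a suitable `Q` turns the single-letter divergence
into the sum of mutual informations in the bound. Each receiver sees its own output only, so the
error probability is the same for all `V` with the same marginals, while `P` does not depend on `V`.

For finite input alphabets a subsequence of the laws `P` converges. The divergence from `Q` may be
discontinuous in `P` where it is infinite; mixing `Q` with a constant channel makes it finite and
linear in `P`, and the weight of the constant channel is then sent to `0`.
-/

noncomputable section

namespace CIFC

section Divergence

variable {α β : Type*} [MeasurableSpace α] [MeasurableSpace β]

lemma klDiv_map_of_leftInverse {μ ν : Measure α} [IsFiniteMeasure μ] [IsFiniteMeasure ν]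
    {f : α → β} {g : β → α} (hf : Measurable f) (hg : Measurable g)
    (hgf : Function.LeftInverse g f) :
    klDiv (μ.map f) (ν.map f) = klDiv μ ν := by
  refine le_antisymm (klDiv_map_le μ ν hf) ?_
  have h := klDiv_map_le (μ.map f) (ν.map f) hg
  rwa [Measure.map_map hg hf, Measure.map_map hg hf, hgf.comp_eq_id, Measure.map_id,
    Measure.map_id] at h

lemma klDiv_prod (μ ν : Measure α) (μ' ν' : Measure β) [IsProbabilityMeasure μ]
    [IsProbabilityMeasure ν] [IsProbabilityMeasure μ'] [IsProbabilityMeasure ν'] :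
    klDiv (μ.prod μ') (ν.prod ν') = klDiv μ ν + klDiv μ' ν' := by
  have hswap : klDiv (μ.prod μ') (μ.prod ν') = klDiv (μ'.prod μ) (ν'.prod μ) := by
    rw [← Measure.prod_swap (μ := μ) (ν := μ'), ← Measure.prod_swap (μ := μ) (ν := ν'),
      klDiv_map_of_leftInverse measurable_swap measurable_swap Prod.swap_leftInverse]
  simp only [← Measure.compProd_const] at hswap ⊢
  rw [klDiv_compProd_eq_add, hswap, klDiv_compProd_left]

lemma klDiv_pi {n : ℕ} {X : Fin n → Type*} [∀ i, MeasurableSpace (X i)]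
    (μ ν : ∀ i, Measure (X i)) [∀ i, IsProbabilityMeasure (μ i)]
    [∀ i, IsProbabilityMeasure (ν i)] :
    klDiv (Measure.pi μ) (Measure.pi ν) = ∑ i, klDiv (μ i) (ν i) := by
  induction n with
  | zero => rw [Subsingleton.elim μ ν, klDiv_self, Fin.sum_univ_zero]
  | succ n ih =>
    let e := MeasurableEquiv.piFinSuccAbove X 0
    rw [← klDiv_map_of_leftInverse e.measurable e.symm.measurable e.left_inv,
      (measurePreserving_piFinSuccAbove μ 0).map_eq, (measurePreserving_piFinSuccAbove ν 0).map_eq,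
      klDiv_prod, ih, Fin.sum_univ_succ]
    rfl

/-- Young's inequality for the conjugate pair `klFun` and `a ↦ exp a - 1`. -/
lemma mul_le_klFun_add_exp {r : ℝ} (hr : 0 ≤ r) (a : ℝ) :
    a * r ≤ klFun r + Real.exp a := by
  rcases hr.eq_or_lt with rfl | hr
  · rw [mul_zero, klFun_zero]; positivity
  · have h := Real.add_one_le_exp (a - Real.log r)
    rw [Real.exp_sub, Real.exp_log hr, le_div_iff₀ hr] at h
    rw [klFun_apply]; linarith

lemma log_mul_measure_le_klDiv_add {μ ν : Measure α} [IsFiniteMeasure μ] [IsFiniteMeasure ν]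
    (s : Set α) {K : ℝ} (hK : 1 ≤ K) :
    ENNReal.ofReal (Real.log K) * μ s ≤ klDiv μ ν + ENNReal.ofReal K * ν s := by
  by_cases hac : μ ≪ ν
  swap
  · rw [klDiv_of_not_ac hac, top_add]; exact le_top
  have pointwise : ∀ᵐ x ∂ν, ENNReal.ofReal (Real.log K) * μ.rnDeriv ν x ≤
      ENNReal.ofReal (klFun (μ.rnDeriv ν x).toReal) + ENNReal.ofReal K := by
    filter_upwards [Measure.rnDeriv_ne_top μ ν] with x hx
    have h := mul_le_klFun_add_exp (ENNReal.toReal_nonneg (a := μ.rnDeriv ν x)) (Real.log K)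
    rw [Real.exp_log (by linarith)] at h
    calc ENNReal.ofReal (Real.log K) * μ.rnDeriv ν x
        = ENNReal.ofReal (Real.log K * (μ.rnDeriv ν x).toReal) := by
          rw [ENNReal.ofReal_mul (Real.log_nonneg hK), ENNReal.ofReal_toReal hx]
      _ ≤ _ := (ENNReal.ofReal_le_ofReal h).trans ENNReal.ofReal_add_le
  calc ENNReal.ofReal (Real.log K) * μ s
      = ∫⁻ x in s, ENNReal.ofReal (Real.log K) * μ.rnDeriv ν x ∂ν := by
        rw [lintegral_const_mul _ (Measure.measurable_rnDeriv _ _),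
          Measure.setLIntegral_rnDeriv hac]
    _ ≤ ∫⁻ x in s, (ENNReal.ofReal (klFun (μ.rnDeriv ν x).toReal) + ENNReal.ofReal K) ∂ν :=
        lintegral_mono_ae (ae_restrict_of_ae pointwise)
    _ = ∫⁻ x in s, ENNReal.ofReal (klFun (μ.rnDeriv ν x).toReal) ∂ν + ENNReal.ofReal K * ν s := by
        rw [lintegral_add_right _ measurable_const, setLIntegral_const]
    _ ≤ klDiv μ ν + ENNReal.ofReal K * ν s := by
        rw [klDiv_eq_lintegral_klFun_of_ac hac]
        gcongr
        exact Measure.restrict_le_self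

lemma log_le_klDiv_add_of_mul_measure_le_one {μ ν : Measure α} [IsProbabilityMeasure μ]
    [IsFiniteMeasure ν] {s : Set α} (hs : MeasurableSet s) {K : ℝ} (hK : 1 ≤ K)
    (hν : ENNReal.ofReal K * ν s ≤ 1) :
    ENNReal.ofReal (Real.log K) ≤ klDiv μ ν + 1 + ENNReal.ofReal (Real.log K) * μ sᶜ := by
  calc ENNReal.ofReal (Real.log K)
      = ENNReal.ofReal (Real.log K) * μ s + ENNReal.ofReal (Real.log K) * μ sᶜ := by
        rw [← mul_add, prob_add_prob_compl hs, mul_one]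
    _ ≤ _ := by grw [log_mul_measure_le_klDiv_add (ν := ν) s hK, hν]

lemma rnDeriv_le_of_le_smul {μ ν : Measure α} [IsFiniteMeasure ν] {b : ℝ≥0∞} (h : μ ≤ b • ν) :
    ∀ᵐ x ∂ν, μ.rnDeriv ν x ≤ b := by
  refine ae_le_of_forall_setLIntegral_le_of_sigmaFinite (Measure.measurable_rnDeriv _ _)
    fun s _ _ => ?_
  rw [setLIntegral_const]
  exact (Measure.setLIntegral_rnDeriv_le s).trans (h s)

lemma klFun_mul_add_le {r s b : ℝ} (hr : 0 ≤ r) (hs : 0 ≤ s) (hsb : s ≤ b) :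
    klFun (r * s) + s ≤ s * klFun r + r * s * Real.log b + 1 := by
  rcases hs.eq_or_lt with rfl | hs
  · simp [klFun_zero]
  rcases hr.eq_or_lt with rfl | hr
  · simp [klFun_zero, add_comm]
  have h := mul_le_mul_of_nonneg_left (Real.log_le_log hs hsb) (mul_pos hr hs).le
  rw [klFun_apply, klFun_apply, Real.log_mul hr.ne' hs.ne']
  linarith

lemma ofReal_klFun_toReal_mul_add_le {r s : ℝ≥0∞} {b : ℝ} (hb : 1 ≤ b) (hrs : r * s ≠ ⊤)
    (hs : s ≤ ENNReal.ofReal b) :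
    ENNReal.ofReal (klFun (r * s).toReal) + s ≤
      s * ENNReal.ofReal (klFun r.toReal) + r * s * ENNReal.ofReal (Real.log b) + 1 := by
  rcases eq_or_ne s 0 with rfl | hs₀
  · simp [klFun_zero]
  lift r to NNReal using fun hr => hrs (by simp [hr, hs₀])
  lift s to NNReal using ne_top_of_le_ne_top ENNReal.ofReal_ne_top hs
  have key := klFun_mul_add_le r.coe_nonneg s.coe_nonneg (b := b)
    (ENNReal.toReal_le_of_le_ofReal (by linarith) hs)
  have hklFun : 0 ≤ klFun r := klFun_nonneg r.coe_nonneg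
  have hlog := Real.log_nonneg hb
  rw [← ENNReal.coe_mul, ← ENNReal.ofReal_coe_nnreal (p := s), ← ENNReal.ofReal_coe_nnreal,
    ← ENNReal.ofReal_one, ← ENNReal.ofReal_mul s.coe_nonneg, ← ENNReal.ofReal_mul (by positivity),
    ← ENNReal.ofReal_add (klFun_nonneg ENNReal.toReal_nonneg) s.coe_nonneg,
    ← ENNReal.ofReal_add (by positivity) (by positivity),
    ← ENNReal.ofReal_add (by positivity) zero_le_one]
  exact ENNReal.ofReal_le_ofReal (by simpa using key)

lemma klDiv_le_add_of_le_smul {μ ν ν' : Measure α} [IsProbabilityMeasure μ]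
    [IsProbabilityMeasure ν] [IsProbabilityMeasure ν'] {b : ℝ}
    (h : ν' ≤ ENNReal.ofReal b • ν) :
    klDiv μ ν ≤ klDiv μ ν' + ENNReal.ofReal (Real.log b) := by
  by_cases hac : μ ≪ ν'
  swap
  · rw [klDiv_of_not_ac hac, top_add]; exact le_top
  have hac' : ν' ≪ ν := Measure.absolutelyContinuous_of_le_smul h
  have hb : 1 ≤ b := by simpa using h Set.univ
  refine (ENNReal.add_le_add_iff_right ENNReal.one_ne_top).1 ?_
  calc klDiv μ ν + 1
      = ∫⁻ x, (ENNReal.ofReal (klFun (μ.rnDeriv ν x).toReal) + ν'.rnDeriv ν x) ∂ν := by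
        rw [lintegral_add_right _ (Measure.measurable_rnDeriv _ _), Measure.lintegral_rnDeriv hac',
          measure_univ, klDiv_eq_lintegral_klFun_of_ac (hac.trans hac')]
    _ ≤ ∫⁻ x, (ν'.rnDeriv ν x * ENNReal.ofReal (klFun (μ.rnDeriv ν' x).toReal)
          + μ.rnDeriv ν x * ENNReal.ofReal (Real.log b) + 1) ∂ν := by
        refine lintegral_mono_ae ?_
        filter_upwards [rnDeriv_le_of_le_smul h, Measure.rnDeriv_mul_rnDeriv hac (κ := ν),
          Measure.rnDeriv_ne_top μ ν] with x hle hmul hne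
        rw [← hmul] at hne ⊢
        exact ofReal_klFun_toReal_mul_add_le hb hne hle
    _ = klDiv μ ν' + ENNReal.ofReal (Real.log b) + 1 := by
        rw [lintegral_add_right _ measurable_const, lintegral_add_right _ (by fun_prop),
          lintegral_rnDeriv_mul hac' (by fun_prop),
          lintegral_mul_const _ (Measure.measurable_rnDeriv _ _),
          Measure.lintegral_rnDeriv (hac.trans hac'), klDiv_eq_lintegral_klFun_of_ac hac]
        simp

section CompProd

variable [MeasurableSpace.CountableOrCountablyGenerated α β] (κ η : Kernel α β)
  [IsMarkovKernel κ] [IsMarkovKernel η]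

lemma klDiv_kernel_eq_lintegral {a : α} (ha : κ a ≪ η a) :
    klDiv (κ a) (η a) = ∫⁻ y, ENNReal.ofReal (klFun (κ.rnDeriv η a y).toReal) ∂η a := by
  rw [klDiv_eq_lintegral_klFun_of_ac ha]
  refine lintegral_congr_ae ?_
  filter_upwards [Kernel.rnDeriv_eq_rnDeriv_measure (κ := κ) (η := η) (a := a)] with y hy
  rw [hy]

lemma measurable_klDiv_kernel : Measurable fun a => klDiv (κ a) (η a) := by
  classical
  have hpiecewise : (fun a => klDiv (κ a) (η a)) = fun a => if κ a ≪ η a then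
      ∫⁻ y, ENNReal.ofReal (klFun (κ.rnDeriv η a y).toReal) ∂η a else ⊤ := by
    ext a
    split_ifs with ha
    exacts [klDiv_kernel_eq_lintegral κ η ha, klDiv_of_not_ac ha]
  rw [hpiecewise]
  exact Measurable.ite (Kernel.measurableSet_absolutelyContinuous κ η)
    (Measurable.lintegral_kernel_prod_right (by fun_prop)) measurable_const

lemma rnDeriv_compProd_right_ae_eq {μ : Measure α} [IsFiniteMeasure μ]
    (hac : ∀ᵐ a ∂μ, κ a ≪ η a) :
    (μ ⊗ₘ κ).rnDeriv (μ ⊗ₘ η) =ᵐ[μ ⊗ₘ η] fun p => κ.rnDeriv η p.1 p.2 := by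
  have heq : μ ⊗ₘ κ = (μ ⊗ₘ η).withDensity fun p => κ.rnDeriv η p.1 p.2 := by
    rw [← Measure.compProd_withDensity (Kernel.measurable_rnDeriv κ η)]
    refine Measure.compProd_congr ?_
    filter_upwards [hac] with a ha using (Kernel.withDensity_rnDeriv_eq ha).symm
  conv_lhs => rw [heq]
  exact Measure.rnDeriv_withDensity _ (Kernel.measurable_rnDeriv κ η)

lemma klDiv_compProd_right (μ : Measure α) [IsFiniteMeasure μ] :
    klDiv (μ ⊗ₘ κ) (μ ⊗ₘ η) = ∫⁻ x, klDiv (κ x) (η x) ∂μ := by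
  by_cases hac : ∀ᵐ a ∂μ, κ a ≪ η a
  · calc klDiv (μ ⊗ₘ κ) (μ ⊗ₘ η)
        = ∫⁻ p, ENNReal.ofReal (klFun (κ.rnDeriv η p.1 p.2).toReal) ∂(μ ⊗ₘ η) := by
          rw [klDiv_eq_lintegral_klFun_of_ac (Measure.AbsolutelyContinuous.compProd_right hac)]
          refine lintegral_congr_ae ?_
          filter_upwards [rnDeriv_compProd_right_ae_eq κ η hac] with p hp
          rw [hp]
      _ = ∫⁻ x, ∫⁻ y, ENNReal.ofReal (klFun (κ.rnDeriv η x y).toReal) ∂η x ∂μ :=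
          Measure.lintegral_compProd (by fun_prop)
      _ = ∫⁻ x, klDiv (κ x) (η x) ∂μ := by
          refine lintegral_congr_ae ?_
          filter_upwards [hac] with a ha using (klDiv_kernel_eq_lintegral κ η ha).symm
  · rw [klDiv_of_not_ac (by rwa [Measure.absolutelyContinuous_compProd_right_iff])]
    refine (lintegral_eq_top_of_measure_eq_top_ne_zero
      (measurable_klDiv_kernel κ η).aemeasurable fun hzero => hac ?_).symm
    filter_upwards [measure_eq_zero_iff_ae_notMem.1 hzero] with a ha
    by_contra hna
    exact ha (klDiv_of_not_ac hna)

end CompProd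

end Divergence

section Information

variable {Ω α β γ δ : Type*} [MeasurableSpace Ω] [MeasurableSpace α] [MeasurableSpace β]
  [MeasurableSpace γ] [MeasurableSpace δ]

lemma map_compProd_comap (μ : Measure α) [SFinite μ] (κ : Kernel β γ) [IsSFiniteKernel κ]
    {g : α → β} (hg : Measurable g) :
    (μ ⊗ₘ κ.comap g hg).map (Prod.map g id) = μ.map g ⊗ₘ κ := by
  ext s hs
  rw [Measure.map_apply (by fun_prop) hs, Measure.compProd_apply (hs.preimage (by fun_prop)),
    Measure.compProd_apply hs, lintegral_map (Kernel.measurable_kernel_prodMk_left hs) hg]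
  rfl

lemma compProd_prod_eq_map (μ : Measure γ) [SFinite μ] (κ : Kernel γ α) [IsSFiniteKernel κ]
    (η : Kernel γ β) [IsSFiniteKernel η] :
    μ ⊗ₘ (κ ×ₖ η) = ((μ ⊗ₘ η) ⊗ₘ κ.comap Prod.fst measurable_fst).map
      fun p => (p.1.1, p.2, p.1.2) := by
  ext s hs
  rw [Measure.map_apply (by fun_prop) hs, Measure.compProd_apply (hs.preimage (by fun_prop)),
    Measure.compProd_apply hs, Measure.lintegral_compProd
      (Kernel.measurable_kernel_prodMk_left (hs.preimage (by fun_prop)))]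
  refine lintegral_congr fun c => ?_
  rw [Kernel.prod_apply, Measure.prod_apply_symm (hs.preimage (by fun_prop))]
  rfl

lemma klDiv_map_compProd_compProd [StandardBorelSpace β] [Nonempty β] (μ : Measure Ω)
    [IsFiniteMeasure μ] {D : Ω → δ} {A : Ω → α} {B : Ω → β} (hD : Measurable D)
    (hA : Measurable A) (hB : Measurable B) (κ : Kernel δ α) [IsMarkovKernel κ]
    (η : Kernel (δ × α) β) [IsMarkovKernel η] :
    klDiv (μ.map fun ω => (D ω, A ω, B ω)) (μ.map D ⊗ₘ (κ ⊗ₖ η)) =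
      klDiv (μ.map fun ω => (D ω, A ω)) (μ.map D ⊗ₘ κ) +
        klDiv (μ.map fun ω => ((D ω, A ω), B ω)) ((μ.map fun ω => (D ω, A ω)) ⊗ₘ η) := by
  have hassoc : (μ.map fun ω => (D ω, A ω, B ω)) =
      (μ.map fun ω => ((D ω, A ω), B ω)).map MeasurableEquiv.prodAssoc := by
    rw [Measure.map_map (MeasurableEquiv.measurable _) (by fun_prop)]; rfl
  rw [hassoc, ← Measure.compProd_assoc', klDiv_map_of_leftInverse (MeasurableEquiv.measurable _)
    (MeasurableEquiv.prodAssoc.symm.measurable) MeasurableEquiv.prodAssoc.symm_apply_apply,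
    ← compProd_map_condDistrib hB.aemeasurable, klDiv_compProd_eq_add]

lemma ofReal_log_two_ne_zero : ENNReal.ofReal (Real.log 2) ≠ 0 := by
  simpa using Real.log_pos one_lt_two

lemma mutualInfo_mul_log_two (μ : Measure Ω) [IsFiniteMeasure μ] {A : Ω → α} {B : Ω → β}
    (hA : Measurable A) (hB : Measurable B) :
    mutualInfo μ A B * ENNReal.ofReal (Real.log 2) =
      klDiv (μ.map fun ω => (B ω, A ω)) (μ.map B ⊗ₘ Kernel.const β (μ.map A)) := by
  have hswap : (μ.map fun ω => (B ω, A ω)) = (μ.map fun ω => (A ω, B ω)).map Prod.swap := by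
    rw [Measure.map_map measurable_swap (by fun_prop)]; rfl
  rw [mutualInfo, ENNReal.div_mul_cancel ofReal_log_two_ne_zero ENNReal.ofReal_ne_top, hswap,
    Measure.compProd_const, ← Measure.prod_swap (μ := μ.map A) (ν := μ.map B),
    klDiv_map_of_leftInverse measurable_swap measurable_swap Prod.swap_leftInverse]

/-- The variable `D` is a coordinate-free presentation of the pair `(C, B) = (f D, h D)`. -/
lemma condMutualInfo_mul_log_two [StandardBorelSpace α] [Nonempty α] [StandardBorelSpace β]
    [Nonempty β] (μ : Measure Ω) [IsFiniteMeasure μ] {A : Ω → α} {D : Ω → δ} (hA : Measurable A)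
    (hD : Measurable D) {f : δ → γ} {h : δ → β} {g : γ × β → δ} (hf : Measurable f)
    (hh : Measurable h) (hg : Measurable g) (hgf : Function.LeftInverse g fun d => (f d, h d)) :
    condMutualInfo μ A (fun ω => h (D ω)) (fun ω => f (D ω)) * ENNReal.ofReal (Real.log 2) =
      klDiv (μ.map fun ω => (D ω, A ω))
        (μ.map D ⊗ₘ (condDistrib A (fun ω => f (D ω)) μ).comap f hf) := by
  set κ := condDistrib A (fun ω => f (D ω)) μ
  have hjoint : (μ.map fun ω => (f (D ω), A ω, h (D ω))) =
      (μ.map fun ω => (D ω, A ω)).map fun p => (f p.1, p.2, h p.1) := by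
    rw [Measure.map_map (by fun_prop) (by fun_prop)]; rfl
  have hindep : μ.map (fun ω => f (D ω)) ⊗ₘ (κ ×ₖ condDistrib (fun ω => h (D ω))
      (fun ω => f (D ω)) μ) = (μ.map D ⊗ₘ κ.comap f hf).map fun p => (f p.1, p.2, h p.1) := by
    have hCB : (μ.map fun ω => (f (D ω), h (D ω))) = (μ.map D).map fun d => (f d, h d) := by
      rw [Measure.map_map (by fun_prop) hD]; rfl
    rw [compProd_prod_eq_map, compProd_map_condDistrib (by fun_prop), hCB,
      ← map_compProd_comap _ _ (by fun_prop), Measure.map_map (by fun_prop) (by fun_prop)]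
    rfl
  rw [condMutualInfo, ENNReal.div_mul_cancel ofReal_log_two_ne_zero ENNReal.ofReal_ne_top, hjoint,
    hindep, klDiv_map_of_leftInverse (g := fun q => (g (q.1, q.2.2), q.2.1)) (by fun_prop)
      (by fun_prop) fun p => Prod.ext (hgf p.1) rfl]

end Information

section TestChannels

variable {X G : Type*} [MeasurableSpace X]

/-- The channels with input `x` whose output law depends on `x` only through `g x`. -/
def channelsThrough {Z : Type*} [MeasurableSpace Z] (g : X → G) : Set (Kernel X Z) :=
  {Q | IsMarkovKernel Q ∧ Function.FactorsThrough Q g}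

lemma const_mem_channelsThrough {Z : Type*} [MeasurableSpace Z] (g : X → G) (q : Measure Z)
    [IsProbabilityMeasure q] : Kernel.const X q ∈ channelsThrough g :=
  ⟨inferInstance, fun _ _ _ => rfl⟩

lemma comap_mem_channelsThrough {Z : Type*} [MeasurableSpace Z] [MeasurableSpace G] {g : X → G}
    (hg : Measurable g) (q : Kernel G Z) [IsMarkovKernel q] : q.comap g hg ∈ channelsThrough g :=
  ⟨inferInstance, fun _ _ hab => congrArg q hab⟩

lemma channelsThrough_subset {Z H : Type*} [MeasurableSpace Z] {g : X → G} {h : X → H}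
    (hgh : Function.FactorsThrough g h) :
    (channelsThrough g : Set (Kernel X Z)) ⊆ channelsThrough h :=
  fun _ hQ => ⟨hQ.1, fun _ _ hab => hQ.2 (hgh hab)⟩

lemma compProd_mem_channelsThrough {Y Z : Type*} [MeasurableSpace Y] [MeasurableSpace Z]
    {g : X → G} {κ : Kernel X Y} {η : Kernel (X × Y) Z} (hκ : κ ∈ channelsThrough g)
    (hη : η ∈ channelsThrough (Prod.map g id)) : κ ⊗ₖ η ∈ channelsThrough g := by
  have := hκ.1
  have := hη.1
  refine ⟨inferInstance, fun a b hab => ?_⟩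
  have hη_eq (y : Y) : η (a, y) = η (b, y) := hη.2 (Prod.ext hab rfl)
  ext s hs
  simp only [Kernel.compProd_apply hs, hκ.2 hab, hη_eq]

lemma compProd_compProd_map_fst {Y Z T : Type*} [MeasurableSpace Y] [MeasurableSpace Z]
    [MeasurableSpace T] (κ : Kernel X Y) [IsSFiniteKernel κ] (η : Kernel (X × Y) Z)
    [IsSFiniteKernel η] (ξ : Kernel ((X × Y) × Z) T) [IsMarkovKernel ξ] :
    (κ ⊗ₖ (η ⊗ₖ ξ)).map (fun y => (y.1, y.2.1)) = κ ⊗ₖ η := by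
  ext x s hs
  rw [Kernel.map_apply' _ (by fun_prop) _ hs,
    Kernel.compProd_apply (hs.preimage (by fun_prop)), Kernel.compProd_apply hs]
  refine lintegral_congr fun y => ?_
  conv_rhs => rw [← Kernel.fst_compProd η ξ,
    Kernel.fst_apply' _ _ (hs.preimage measurable_prodMk_left)]
  rfl

variable {X₁ X₂ X₃ Y₁ Y₂ Y₃ : Type*}
  [MeasurableSpace X₁] [MeasurableSpace X₂] [MeasurableSpace X₃]
  [MeasurableSpace Y₁] [MeasurableSpace Y₂] [MeasurableSpace Y₃]

/-- The channels to the receivers 2 and 3 under which `(y₂, y₃)` carries no information about `x₃`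
beyond `(x₁, x₂)`, and `y₂` none about `x₂` beyond `x₁`: under such a channel receiver 3 has to
guess its message, and so has receiver 2. -/
def testChannels₂₃ : Set (Kernel (X₁ × X₂ × X₃) (Y₂ × Y₃)) :=
  {Q | Q ∈ channelsThrough (fun x => (x.1, x.2.1)) ∧ Q.fst ∈ channelsThrough Prod.fst}

/-- The channels to all three receivers under which each receiver has to guess its message, even
jointly with the receivers before it: `(y₁, y₂, y₃)` depends on `(x₁, x₂)` only, `(y₁, y₂)` on `x₁`
only, and `y₁` on none of the inputs. -/
def testChannels₁₂₃ : Set (Kernel (X₁ × X₂ × X₃) (Y₁ × Y₂ × Y₃)) :=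
  {Q | Q ∈ channelsThrough (fun x => (x.1, x.2.1)) ∧
    Q.map (fun y => (y.1, y.2.1)) ∈ channelsThrough Prod.fst ∧
    Q.fst ∈ channelsThrough fun _ => ()}

lemma compProd_mem_testChannels₂₃ (q₂ : Kernel X₁ Y₂) [IsMarkovKernel q₂]
    (q₃ : Kernel (X₁ × X₂ × Y₂) Y₃) [IsMarkovKernel q₃] :
    q₂.comap Prod.fst measurable_fst ⊗ₖ
      q₃.comap (fun p : (X₁ × X₂ × X₃) × Y₂ => (p.1.1, p.1.2.1, p.2)) (by fun_prop) ∈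
        testChannels₂₃ := by
  refine ⟨compProd_mem_channelsThrough (channelsThrough_subset (fun a b hab => ?_)
    (comap_mem_channelsThrough _ _)) (channelsThrough_subset (fun a b hab => ?_)
      (comap_mem_channelsThrough _ _)), ?_⟩
  · exact (Prod.ext_iff.1 hab).1
  · simp_all [Prod.ext_iff]
  · rw [Kernel.fst_compProd]
    exact comap_mem_channelsThrough _ _

lemma compProd_mem_testChannels₁₂₃ (q₁ : Measure Y₁) [IsProbabilityMeasure q₁]
    (q₂ : Kernel (X₁ × Y₁) Y₂) [IsMarkovKernel q₂] (q₃ : Kernel (X₁ × Y₁ × X₂ × Y₂) Y₃)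
    [IsMarkovKernel q₃] :
    Kernel.const _ q₁ ⊗ₖ
      (q₂.comap (fun p : (X₁ × X₂ × X₃) × Y₁ => (p.1.1, p.2)) (by fun_prop) ⊗ₖ
        q₃.comap (fun p : ((X₁ × X₂ × X₃) × Y₁) × Y₂ => (p.1.1.1, p.1.2, p.1.1.2.1, p.2))
          (by fun_prop)) ∈ testChannels₁₂₃ := by
  refine ⟨compProd_mem_channelsThrough (const_mem_channelsThrough _ _)
    (compProd_mem_channelsThrough
      (channelsThrough_subset (fun a b hab => ?_) (comap_mem_channelsThrough _ _))
      (channelsThrough_subset (fun a b hab => ?_) (comap_mem_channelsThrough _ _))), ?_, ?_⟩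
  · simp_all [Prod.ext_iff]
  · simp_all [Prod.ext_iff]
  · rw [compProd_compProd_map_fst]
    exact compProd_mem_channelsThrough (const_mem_channelsThrough _ _)
      (comap_mem_channelsThrough _ _)
  · rw [Kernel.fst_compProd]
    exact const_mem_channelsThrough _ _

end TestChannels

section Divergence

variable {X Y Z G B : Type*} [MeasurableSpace X] [MeasurableSpace Y] [MeasurableSpace Z]
  [MeasurableSpace G] [MeasurableSpace B]

lemma klDiv_compProd_map (P : Measure X) [SFinite P] (V : Kernel X Y) [IsMarkovKernel V]
    {f : Y → Z} (hf : Measurable f) (Q : Kernel X Z) :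
    klDiv (P ⊗ₘ V.map f) (P ⊗ₘ Q) =
      klDiv ((P ⊗ₘ V).map fun ω => (ω.1, f ω.2)) ((P ⊗ₘ V).map Prod.fst ⊗ₘ Q) := by
  rw [Measure.compProd_map hf, ← Measure.fst, Measure.fst_compProd]
  rfl

lemma exists_klDiv_eq_mutualInfo (P : Measure X) [IsProbabilityMeasure P] (V : Kernel X Y)
    [IsMarkovKernel V] {f : Y → Z} (hf : Measurable f) :
    ∃ Q ∈ channelsThrough (fun _ => ()), klDiv (P ⊗ₘ V.map f) (P ⊗ₘ Q) =
      mutualInfo (P ⊗ₘ V) (fun ω => f ω.2) (fun ω => ω.1) * ENNReal.ofReal (Real.log 2) := by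
  have := Measure.isProbabilityMeasure_map (μ := P ⊗ₘ V) (f := fun ω => f ω.2) (by fun_prop)
  refine ⟨Kernel.const _ ((P ⊗ₘ V).map fun ω => f ω.2), const_mem_channelsThrough _ _, ?_⟩
  rw [mutualInfo_mul_log_two _ (by fun_prop) (by fun_prop), klDiv_compProd_map P V hf]

lemma exists_klDiv_eq_condMutualInfo [StandardBorelSpace Z] [Nonempty Z] [StandardBorelSpace B]
    [Nonempty B] (P : Measure X) [IsFiniteMeasure P] (V : Kernel X Y) [IsMarkovKernel V]
    {f : Y → Z} (hf : Measurable f) {g : X → G} (hg : Measurable g) {h : X → B}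
    (hh : Measurable h) {k : G × B → X} (hk : Measurable k)
    (hkgh : Function.LeftInverse k fun x => (g x, h x)) :
    ∃ Q ∈ channelsThrough g, klDiv (P ⊗ₘ V.map f) (P ⊗ₘ Q) =
      condMutualInfo (P ⊗ₘ V) (fun ω => f ω.2) (fun ω => h ω.1) (fun ω => g ω.1)
        * ENNReal.ofReal (Real.log 2) := by
  refine ⟨_, comap_mem_channelsThrough hg
    (condDistrib (fun ω => f ω.2) (fun ω => g ω.1) (P ⊗ₘ V)), ?_⟩
  rw [klDiv_compProd_map P V hf, ← condMutualInfo_mul_log_two _ (by fun_prop) measurable_fst hg hh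
    hk hkgh]

end Divergence

section TestDivergence

variable {X₁ X₂ X₃ Y₁ Y₂ Y₃ : Type*}
  [MeasurableSpace X₁] [MeasurableSpace X₂] [MeasurableSpace X₃]
  [MeasurableSpace Y₁] [MeasurableSpace Y₂] [MeasurableSpace Y₃]
  [StandardBorelSpace X₂] [Nonempty X₂] [StandardBorelSpace X₃] [Nonempty X₃]
  [StandardBorelSpace Y₂] [Nonempty Y₂] [StandardBorelSpace Y₃] [Nonempty Y₃]
  (P : Measure (X₁ × X₂ × X₃)) [IsProbabilityMeasure P]
  (V : Kernel (X₁ × X₂ × X₃) (Y₁ × Y₂ × Y₃)) [IsMarkovKernel V]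

lemma exists_testChannel₂₃_klDiv_eq :
    ∃ Q ∈ testChannels₂₃, klDiv (P ⊗ₘ V.map Prod.snd) (P ⊗ₘ Q) =
      (condMutualInfo (P ⊗ₘ V) (fun ω => ω.2.2.1) (fun ω => ω.1.2) (fun ω => ω.1.1) +
        condMutualInfo (P ⊗ₘ V) (fun ω => ω.2.2.2) (fun ω => ω.1.2.2)
          (fun ω => (ω.1.1, ω.1.2.1, ω.2.2.1))) * ENNReal.ofReal (Real.log 2) := by
  refine ⟨_, compProd_mem_testChannels₂₃
    (condDistrib (fun ω => ω.2.2.1) (fun ω => ω.1.1) (P ⊗ₘ V))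
    (condDistrib (fun ω => ω.2.2.2) (fun ω => (ω.1.1, ω.1.2.1, ω.2.2.1)) (P ⊗ₘ V)), ?_⟩
  rw [klDiv_compProd_map P V measurable_snd,
    klDiv_map_compProd_compProd _ (by fun_prop) (by fun_prop) (by fun_prop), add_mul]
  congr 1
  · exact (condMutualInfo_mul_log_two _ (D := Prod.fst) (h := Prod.snd) (g := id) (by fun_prop)
      measurable_fst measurable_fst measurable_snd measurable_id fun _ => rfl).symm
  · exact (condMutualInfo_mul_log_two _ (D := fun ω : (X₁ × X₂ × X₃) × Y₁ × Y₂ × Y₃ =>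
      (ω.1, ω.2.2.1)) (f := fun d : (X₁ × X₂ × X₃) × Y₂ => (d.1.1, d.1.2.1, d.2))
      (h := fun d => d.1.2.2)
      (g := fun q : (X₁ × X₂ × Y₂) × X₃ => ((q.1.1, q.1.2.1, q.2), q.1.2.2)) (by fun_prop)
      (by fun_prop) (by fun_prop) (by fun_prop) (by fun_prop) fun _ => rfl).symm

lemma exists_testChannel₁₂₃_klDiv_eq :
    ∃ Q ∈ testChannels₁₂₃, klDiv (P ⊗ₘ V) (P ⊗ₘ Q) =
      (mutualInfo (P ⊗ₘ V) (fun ω => ω.2.1) (fun ω => ω.1) +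
        condMutualInfo (P ⊗ₘ V) (fun ω => ω.2.2.1) (fun ω => ω.1.2) (fun ω => (ω.1.1, ω.2.1)) +
        condMutualInfo (P ⊗ₘ V) (fun ω => ω.2.2.2) (fun ω => ω.1.2.2)
          (fun ω => (ω.1.1, ω.2.1, ω.1.2.1, ω.2.2.1))) * ENNReal.ofReal (Real.log 2) := by
  have := Measure.isProbabilityMeasure_map (μ := P ⊗ₘ V) (f := fun ω => ω.2.1) (by fun_prop)
  refine ⟨_, compProd_mem_testChannels₁₂₃ ((P ⊗ₘ V).map fun ω => ω.2.1)
    (condDistrib (fun ω => ω.2.2.1) (fun ω => (ω.1.1, ω.2.1)) (P ⊗ₘ V))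
    (condDistrib (fun ω => ω.2.2.2) (fun ω => (ω.1.1, ω.2.1, ω.1.2.1, ω.2.2.1)) (P ⊗ₘ V)), ?_⟩
  have hid (Q : Kernel (X₁ × X₂ × X₃) (Y₁ × Y₂ × Y₃)) : klDiv (P ⊗ₘ V) (P ⊗ₘ Q) =
      klDiv ((P ⊗ₘ V).map fun ω => (ω.1, ω.2.1, ω.2.2)) ((P ⊗ₘ V).map Prod.fst ⊗ₘ Q) := by
    have h := klDiv_compProd_map P V measurable_id Q
    rwa [Kernel.map_id] at h
  rw [hid, klDiv_map_compProd_compProd _ (by fun_prop) (by fun_prop) (by fun_prop),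
    klDiv_map_compProd_compProd _ (by fun_prop) (by fun_prop) (by fun_prop), add_mul, add_mul,
    ← add_assoc]
  congr 2
  · exact (mutualInfo_mul_log_two _ (by fun_prop) (by fun_prop)).symm
  · exact (condMutualInfo_mul_log_two _ (D := fun ω : (X₁ × X₂ × X₃) × Y₁ × Y₂ × Y₃ =>
      (ω.1, ω.2.1)) (f := fun d : (X₁ × X₂ × X₃) × Y₁ => (d.1.1, d.2)) (h := fun d => d.1.2)
      (g := fun q : (X₁ × Y₁) × X₂ × X₃ => ((q.1.1, q.2), q.1.2)) (by fun_prop)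
      (by fun_prop) (by fun_prop) (by fun_prop) (by fun_prop) fun _ => rfl).symm
  · exact (condMutualInfo_mul_log_two _ (D := fun ω : (X₁ × X₂ × X₃) × Y₁ × Y₂ × Y₃ =>
      ((ω.1, ω.2.1), ω.2.2.1))
      (f := fun d : ((X₁ × X₂ × X₃) × Y₁) × Y₂ => (d.1.1.1, d.1.2, d.1.1.2.1, d.2))
      (h := fun d => d.1.1.2.2)
      (g := fun q : (X₁ × Y₁ × X₂ × Y₂) × X₃ =>
        (((q.1.1, q.1.2.2.1, q.2), q.1.2.1), q.1.2.2.2)) (by fun_prop) (by fun_prop)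
      (by fun_prop) (by fun_prop) (by fun_prop) fun _ => rfl).symm

end TestDivergence

section BlockLaw

/-- The law of the channel input at a uniformly chosen time, for a uniform message. -/
def empiricalLaw {ι X : Type*} [MeasurableSpace ι] [MeasurableSpace X] {N : ℕ}
    (x : ι → Fin N → X) : Measure X :=
  (uniformOn (Set.univ : Set (ι × Fin N))).map (Function.uncurry x)

lemma isProbabilityMeasure_empiricalLaw {ι X : Type*} [MeasurableSpace ι]
    [MeasurableSingletonClass ι] [MeasurableSpace X] [Finite ι] [Nonempty ι] {N : ℕ} [NeZero N]
    (x : ι → Fin N → X) :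
    IsProbabilityMeasure (empiricalLaw x) :=
  Measure.isProbabilityMeasure_map (Measurable.of_discrete (f := Function.uncurry x)).aemeasurable

variable {ι X Y Z : Type*} [Fintype ι] [MeasurableSpace ι] [MeasurableSingletonClass ι]
  [MeasurableSpace X] [MeasurableSpace Y] [MeasurableSpace Z] {N : ℕ}

lemma lintegral_uniformOn_univ (f : ι → ℝ≥0∞) :
    ∫⁻ i, f i ∂uniformOn Set.univ = (Fintype.card ι : ℝ≥0∞)⁻¹ * ∑ i, f i := by
  rw [lintegral_fintype, Finset.mul_sum]
  refine Finset.sum_congr rfl fun i _ => ?_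
  rw [uniformOn_univ, Measure.count_singleton, one_div, mul_comm]

/-- The memoryless channel from the messages `i` to the output blocks, when the message `i` is sent
as the codeword `x i` and each letter passes independently through `Q`. -/
def blockKernel (Q : Kernel X Z) (x : ι → Fin N → X) : Kernel ι (Fin N → Z) :=
  Kernel.ofFunOfCountable fun i => Measure.pi fun t => Q (x i t)

instance (Q : Kernel X Z) [IsMarkovKernel Q] (x : ι → Fin N → X) :
    IsMarkovKernel (blockKernel Q x) :=
  ⟨fun i => inferInstanceAs (IsProbabilityMeasure (Measure.pi fun t => Q (x i t)))⟩

/-- The joint law of a uniform message and of its output block. -/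
def blockLaw (Q : Kernel X Z) (x : ι → Fin N → X) : Measure (ι × (Fin N → Z)) :=
  uniformOn Set.univ ⊗ₘ blockKernel Q x

instance [Nonempty ι] (Q : Kernel X Z) [IsMarkovKernel Q] (x : ι → Fin N → X) :
    IsProbabilityMeasure (blockLaw Q x) :=
  inferInstanceAs (IsProbabilityMeasure (uniformOn Set.univ ⊗ₘ blockKernel Q x))

lemma blockLaw_apply (Q : Kernel X Z) [IsMarkovKernel Q] (x : ι → Fin N → X)
    {s : Set (ι × (Fin N → Z))} (hs : MeasurableSet s) :
    blockLaw Q x s =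
      (Fintype.card ι : ℝ≥0∞)⁻¹ * ∑ i, Measure.pi (fun t => Q (x i t)) (Prod.mk i ⁻¹' s) := by
  rw [blockLaw, Measure.compProd_apply hs, lintegral_uniformOn_univ]
  rfl

lemma blockLaw_map (Q : Kernel X Y) [IsMarkovKernel Q] (x : ι → Fin N → X) {f : Y → Z}
    (hf : Measurable f) {s : Set (ι × (Fin N → Z))} (hs : MeasurableSet s) :
    blockLaw (Q.map f) x s = blockLaw Q x {p | (p.1, fun t => f (p.2 t)) ∈ s} := by
  have := Kernel.IsMarkovKernel.map Q hf
  have (i : ι) (t : Fin N) := Measure.isProbabilityMeasure_map (μ := Q (x i t)) hf.aemeasurable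
  have hs' : MeasurableSet {p : ι × (Fin N → Y) | (p.1, fun t => f (p.2 t)) ∈ s} :=
    hs.preimage (by fun_prop)
  rw [blockLaw_apply _ _ hs, blockLaw_apply _ _ hs']
  congr! 2 with i
  simp only [Kernel.map_apply _ hf]
  rw [← Measure.pi_map_pi fun _ => hf.aemeasurable,
    Measure.map_apply (by fun_prop) (hs.preimage measurable_prodMk_left)]
  rfl

lemma klDiv_blockLaw [Nonempty ι] [NeZero N] [MeasurableSpace.CountableOrCountablyGenerated X Z]
    (V Q : Kernel X Z) [IsMarkovKernel V] [IsMarkovKernel Q] (x : ι → Fin N → X) :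
    klDiv (blockLaw V x) (blockLaw Q x) =
      N * klDiv (empiricalLaw x ⊗ₘ V) (empiricalLaw x ⊗ₘ Q) := by
  have := isProbabilityMeasure_empiricalLaw x
  have hN : (N : ℝ≥0∞) ≠ 0 := NeZero.ne _
  have hpi (i : ι) : klDiv (blockKernel V x i) (blockKernel Q x i) =
      ∑ t, klDiv (V (x i t)) (Q (x i t)) :=
    klDiv_pi (fun t => V (x i t)) fun t => Q (x i t)
  rw [blockLaw, blockLaw, klDiv_compProd_right, klDiv_compProd_right, empiricalLaw,
    lintegral_map (measurable_klDiv_kernel V Q) Measurable.of_discrete, lintegral_uniformOn_univ,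
    lintegral_uniformOn_univ, Fintype.sum_prod_type, Fintype.card_prod, Fintype.card_fin,
    Nat.cast_mul, ENNReal.mul_inv (by simp) (by simp), mul_left_comm, mul_assoc,
    ENNReal.inv_mul_cancel_left hN (ENNReal.natCast_ne_top N)]
  simp only [hpi, Function.uncurry]

/-- A receiver whose observation does not depend on the component `b` of the message `(a, b)` is
right for one value of `b` at a time. -/
lemma card_mul_blockLaw_guess_le {G A B : Type*} [Finite A] [MeasurableSpace A] [Fintype B]
    [MeasurableSpace B] [MeasurableSingletonClass B]
    {Q : Kernel X Z} {g : X → G} (hQ : Q ∈ channelsThrough g) (e : ι ≃ A × B)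
    {x : ι → Fin N → X} (hx : ∀ i j, (e i).1 = (e j).1 → ∀ t, g (x i t) = g (x j t))
    {d : (Fin N → Z) → B} (hd : Measurable d) {E : Set (A × (Fin N → Z))} (hE : MeasurableSet E) :
    Fintype.card B * blockLaw Q x {p | ((e p.1).1, p.2) ∈ E ∧ d p.2 = (e p.1).2} ≤
      blockLaw Q x {p | ((e p.1).1, p.2) ∈ E} := by
  have := Fintype.ofFinite A
  have := hQ.1
  have he : Measurable e := .of_discrete
  have hE' : MeasurableSet {p : ι × (Fin N → Z) | ((e p.1).1, p.2) ∈ E} :=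
    hE.preimage (by fun_prop)
  have hdec : MeasurableSet
      {p : ι × (Fin N → Z) | ((e p.1).1, p.2) ∈ E ∧ d p.2 = (e p.1).2} :=
    hE'.inter (measurableSet_eq_fun (by fun_prop) (by fun_prop))
  rw [blockLaw_apply _ _ hdec, blockLaw_apply _ _ hE', mul_left_comm,
    ← e.symm.sum_comp, ← e.symm.sum_comp, Fintype.sum_prod_type, Fintype.sum_prod_type,
    Finset.mul_sum]
  gcongr with a
  have hlaw (b b' : B) : (fun t => Q (x (e.symm (a, b)) t)) = fun t => Q (x (e.symm (a, b')) t) :=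
    funext fun t => hQ.2 (hx _ _ (by simp) t)
  simp only [Set.preimage_ofPred_eq, Equiv.apply_symm_apply]
  obtain hB | ⟨⟨b₀⟩⟩ := isEmpty_or_nonempty B
  · simp
  simp only [hlaw _ b₀, Finset.sum_const, Finset.card_univ, nsmul_eq_mul]
  gcongr
  set ν := (Measure.pi fun t => Q (x (e.symm (a, b₀)) t)).restrict {z | (a, z) ∈ E}
  calc ∑ b, _ = ∑ b, ν (d ⁻¹' {b}) := by
        refine Finset.sum_congr rfl fun b _ => ?_
        rw [Measure.restrict_apply (hd (measurableSet_singleton b)), Set.inter_comm]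
        rfl
    _ ≤ _ := by
        rw [sum_measure_preimage_singleton _ fun b _ => hd (measurableSet_singleton b)]
        simp [ν]

end BlockLaw

section Guessing

variable {X₁ X₂ X₃ Y₁ Y₂ Y₃ Z : Type*}
  [MeasurableSpace X₁] [MeasurableSpace X₂] [MeasurableSpace X₃]
  [MeasurableSpace Y₁] [MeasurableSpace Y₂] [MeasurableSpace Y₃] [MeasurableSpace Z]
  {N M₁ M₂ M₃ : ℕ} (c : Code X₁ X₂ X₃ Y₁ Y₂ Y₃ N M₁ M₂ M₃)

/-- The codeword triple sent for the messages `w`. -/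
def Code.input (w : Fin M₁ × Fin M₂ × Fin M₃) (t : Fin N) : X₁ × X₂ × X₃ :=
  (c.enc₁ w.1 t, c.enc₂ w.1 w.2.1 t, c.enc₃ w.1 w.2.1 w.2.2 t)

lemma Code.mul_blockLaw_guess₁_le [NeZero M₁] [NeZero M₂] [NeZero M₃]
    {Q : Kernel (X₁ × X₂ × X₃) Z} (hQ : Q ∈ channelsThrough fun _ => ())
    {d : (Fin N → Z) → Fin M₁} (hd : Measurable d) :
    M₁ * blockLaw Q c.input {p | d p.2 = p.1.1} ≤ 1 := by
  have := hQ.1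
  have h := card_mul_blockLaw_guess_le hQ (Equiv.prodComm (Fin M₁) (Fin M₂ × Fin M₃))
    (x := c.input) (fun _ _ _ _ => rfl) hd MeasurableSet.univ
  simp only [Set.mem_univ, true_and, Fintype.card_fin, Equiv.prodComm_apply, Prod.snd_swap] at h
  exact h.trans prob_le_one

lemma Code.mul_blockLaw_guess₂_le {Q : Kernel (X₁ × X₂ × X₃) Z} (hQ : Q ∈ channelsThrough Prod.fst)
    {d : (Fin N → Z) → Fin M₂} (hd : Measurable d) {E : Set (Fin M₁ × (Fin N → Z))}
    (hE : MeasurableSet E) :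
    M₂ * blockLaw Q c.input {p | (p.1.1, p.2) ∈ E ∧ d p.2 = p.1.2.1} ≤
      blockLaw Q c.input {p | (p.1.1, p.2) ∈ E} := by
  let e : Fin M₁ × Fin M₂ × Fin M₃ ≃ (Fin M₁ × Fin M₃) × Fin M₂ :=
    ⟨fun w => ((w.1, w.2.2), w.2.1), fun v => (v.1.1, v.2, v.1.2), fun _ => rfl, fun _ => rfl⟩
  have hx (w w' : Fin M₁ × Fin M₂ × Fin M₃) (hw : (e w).1 = (e w').1) (t : Fin N) :
      (c.input w t).1 = (c.input w' t).1 :=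
    congrArg (fun a => c.enc₁ a t) (Prod.ext_iff.1 hw).1
  have hE' : MeasurableSet {q : (Fin M₁ × Fin M₃) × (Fin N → Z) | (q.1.1, q.2) ∈ E} :=
    hE.preimage (by fun_prop)
  have h := card_mul_blockLaw_guess_le hQ e hx hd hE'
  rwa [Fintype.card_fin] at h

lemma Code.mul_blockLaw_guess₃_le {Q : Kernel (X₁ × X₂ × X₃) Z}
    (hQ : Q ∈ channelsThrough fun x => (x.1, x.2.1)) {d : (Fin N → Z) → Fin M₃}
    (hd : Measurable d) {E : Set ((Fin M₁ × Fin M₂) × (Fin N → Z))} (hE : MeasurableSet E) :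
    M₃ * blockLaw Q c.input {p | ((p.1.1, p.1.2.1), p.2) ∈ E ∧ d p.2 = p.1.2.2} ≤
      blockLaw Q c.input {p | ((p.1.1, p.1.2.1), p.2) ∈ E} := by
  have hx (w w' : Fin M₁ × Fin M₂ × Fin M₃) (hw : (w.1, w.2.1) = (w'.1, w'.2.1)) (t : Fin N) :
      ((c.input w t).1, (c.input w t).2.1) = ((c.input w' t).1, (c.input w' t).2.1) :=
    congrArg (fun v : Fin M₁ × Fin M₂ => (c.enc₁ v.1 t, c.enc₂ v.1 v.2 t)) hw
  have h := card_mul_blockLaw_guess_le hQ (Equiv.prodAssoc _ _ _).symm hx hd hE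
  rwa [Fintype.card_fin] at h

variable [NeZero M₁] [NeZero M₂] [NeZero M₃]

lemma Code.mul_blockLaw_correct₂_le {Q : Kernel (X₁ × X₂ × X₃) Y₂}
    (hQ : Q ∈ channelsThrough Prod.fst) :
    M₂ * blockLaw Q c.input {p | c.dec₂ p.2 = p.1.2.1} ≤ 1 := by
  have := hQ.1
  simpa using (c.mul_blockLaw_guess₂_le hQ c.measurable_dec₂ MeasurableSet.univ).trans prob_le_one

lemma Code.mul_blockLaw_correct₃_le {Q : Kernel (X₁ × X₂ × X₃) Y₃}
    (hQ : Q ∈ channelsThrough fun x => (x.1, x.2.1)) :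
    M₃ * blockLaw Q c.input {p | c.dec₃ p.2 = p.1.2.2} ≤ 1 := by
  have := hQ.1
  simpa using (c.mul_blockLaw_guess₃_le hQ c.measurable_dec₃ MeasurableSet.univ).trans prob_le_one

lemma Code.mul_blockLaw_correct₂₃_le {Q : Kernel (X₁ × X₂ × X₃) (Y₂ × Y₃)}
    (hQ : Q ∈ testChannels₂₃) :
    M₂ * M₃ * blockLaw Q c.input
      {p | c.dec₂ (fun t => (p.2 t).1) = p.1.2.1 ∧ c.dec₃ (fun t => (p.2 t).2) = p.1.2.2} ≤ 1 := by
  have := hQ.1.1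
  have hd₂ := c.measurable_dec₂
  have hd₃ := c.measurable_dec₃
  have hE : MeasurableSet {q : (Fin M₁ × Fin M₂) × (Fin N → Y₂ × Y₃) |
      c.dec₂ (fun t => (q.2 t).1) = q.1.2} := measurableSet_eq_fun (by fun_prop) (by fun_prop)
  have hS : MeasurableSet {p : (Fin M₁ × Fin M₂ × Fin M₃) × (Fin N → Y₂) | c.dec₂ p.2 = p.1.2.1} :=
    measurableSet_eq_fun (by fun_prop) (by fun_prop)
  calc _ = (M₂ : ℝ≥0∞) * (M₃ * blockLaw Q c.input _) := mul_assoc _ _ _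
    _ ≤ M₂ * blockLaw Q c.input {p | c.dec₂ (fun t => (p.2 t).1) = p.1.2.1} := by
        gcongr
        exact c.mul_blockLaw_guess₃_le hQ.1 (d := fun z => c.dec₃ fun t => (z t).2)
          (by fun_prop) hE
    _ = M₂ * blockLaw Q.fst c.input {p | c.dec₂ p.2 = p.1.2.1} := by
        rw [Kernel.fst_eq, blockLaw_map _ _ measurable_fst hS]
        rfl
    _ ≤ 1 := c.mul_blockLaw_correct₂_le hQ.2

lemma Code.mul_blockLaw_correct₁₂_le {Q : Kernel (X₁ × X₂ × X₃) (Y₁ × Y₂)}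
    (hQ : Q ∈ channelsThrough Prod.fst) (hQ₁ : Q.fst ∈ channelsThrough fun _ => ()) :
    M₁ * M₂ * blockLaw Q c.input
      {p | c.dec₁ (fun t => (p.2 t).1) = p.1.1 ∧ c.dec₂ (fun t => (p.2 t).2) = p.1.2.1} ≤ 1 := by
  have := hQ.1
  have hd₁ := c.measurable_dec₁
  have hd₂ := c.measurable_dec₂
  have hE : MeasurableSet {q : Fin M₁ × (Fin N → Y₁ × Y₂) | c.dec₁ (fun t => (q.2 t).1) = q.1} :=
    measurableSet_eq_fun (by fun_prop) (by fun_prop)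
  have hS : MeasurableSet {p : (Fin M₁ × Fin M₂ × Fin M₃) × (Fin N → Y₁) | c.dec₁ p.2 = p.1.1} :=
    measurableSet_eq_fun (by fun_prop) (by fun_prop)
  calc _ = (M₁ : ℝ≥0∞) * (M₂ * blockLaw Q c.input _) := mul_assoc _ _ _
    _ ≤ M₁ * blockLaw Q c.input {p | c.dec₁ (fun t => (p.2 t).1) = p.1.1} := by
        gcongr
        exact c.mul_blockLaw_guess₂_le hQ (d := fun z => c.dec₂ fun t => (z t).2) (by fun_prop) hE
    _ = M₁ * blockLaw Q.fst c.input {p | c.dec₁ p.2 = p.1.1} := by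
        rw [Kernel.fst_eq, blockLaw_map _ _ measurable_fst hS]
        rfl
    _ ≤ 1 := c.mul_blockLaw_guess₁_le hQ₁ hd₁

lemma Code.mul_blockLaw_correct₁₂₃_le {Q : Kernel (X₁ × X₂ × X₃) (Y₁ × Y₂ × Y₃)}
    (hQ : Q ∈ testChannels₁₂₃) :
    M₁ * M₂ * M₃ * blockLaw Q c.input {p | (c.dec₁ (fun t => (p.2 t).1) = p.1.1 ∧
      c.dec₂ (fun t => (p.2 t).2.1) = p.1.2.1) ∧ c.dec₃ (fun t => (p.2 t).2.2) = p.1.2.2} ≤ 1 := by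
  have := hQ.1.1
  have hd₁ := c.measurable_dec₁
  have hd₂ := c.measurable_dec₂
  have hd₃ := c.measurable_dec₃
  have hfst : (Q.map fun y => (y.1, y.2.1)).fst = Q.fst := by
    rw [Kernel.fst_eq, Kernel.fst_eq, ← Kernel.map_comp_right _ (by fun_prop) (by fun_prop)]
    rfl
  have hE : MeasurableSet {q : (Fin M₁ × Fin M₂) × (Fin N → Y₁ × Y₂ × Y₃) |
      c.dec₁ (fun t => (q.2 t).1) = q.1.1 ∧ c.dec₂ (fun t => (q.2 t).2.1) = q.1.2} :=
    (measurableSet_eq_fun (by fun_prop) (by fun_prop)).inter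
      (measurableSet_eq_fun (by fun_prop) (by fun_prop))
  have hS : MeasurableSet {p : (Fin M₁ × Fin M₂ × Fin M₃) × (Fin N → Y₁ × Y₂) |
      c.dec₁ (fun t => (p.2 t).1) = p.1.1 ∧ c.dec₂ (fun t => (p.2 t).2) = p.1.2.1} :=
    (measurableSet_eq_fun (by fun_prop) (by fun_prop)).inter
      (measurableSet_eq_fun (by fun_prop) (by fun_prop))
  calc _ = (M₁ : ℝ≥0∞) * M₂ * (M₃ * blockLaw Q c.input _) := mul_assoc _ _ _
    _ ≤ M₁ * M₂ * blockLaw Q c.input {p | c.dec₁ (fun t => (p.2 t).1) = p.1.1 ∧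
          c.dec₂ (fun t => (p.2 t).2.1) = p.1.2.1} := by
        gcongr
        exact c.mul_blockLaw_guess₃_le hQ.1 (d := fun z => c.dec₃ fun t => (z t).2.2)
          (by fun_prop) hE
    _ = M₁ * M₂ * blockLaw (Q.map fun y => (y.1, y.2.1)) c.input
          {p | c.dec₁ (fun t => (p.2 t).1) = p.1.1 ∧ c.dec₂ (fun t => (p.2 t).2) = p.1.2.1} := by
        rw [blockLaw_map _ _ (by fun_prop) hS]
        rfl
    _ ≤ 1 := c.mul_blockLaw_correct₁₂_le hQ.2.1 (hfst ▸ hQ.2.2)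

end Guessing

section Converse

variable {X₁ X₂ X₃ Y₁ Y₂ Y₃ Z : Type*}
  [MeasurableSpace X₁] [MeasurableSpace X₂] [MeasurableSpace X₃]
  [MeasurableSpace Y₁] [MeasurableSpace Y₂] [MeasurableSpace Y₃] [MeasurableSpace Z]
  {N M₁ M₂ M₃ : ℕ} (c : Code X₁ X₂ X₃ Y₁ Y₂ Y₃ N M₁ M₂ M₃)

lemma Code.law_eq_blockLaw (V : Kernel (X₁ × X₂ × X₃) (Y₁ × Y₂ × Y₃)) :
    c.law V = blockLaw V c.input := rfl

lemma Code.law_preimage_congr {V W : Kernel (X₁ × X₂ × X₃) (Y₁ × Y₂ × Y₃)} [IsMarkovKernel V]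
    [IsMarkovKernel W] {f : Y₁ × Y₂ × Y₃ → Z} (hf : Measurable f) (h : V.map f = W.map f)
    {s : Set ((Fin M₁ × Fin M₂ × Fin M₃) × (Fin N → Z))} (hs : MeasurableSet s) :
    c.law V {p | (p.1, fun t => f (p.2 t)) ∈ s} = c.law W {p | (p.1, fun t => f (p.2 t)) ∈ s} := by
  rw [law_eq_blockLaw, law_eq_blockLaw, ← blockLaw_map V _ hf hs, h, blockLaw_map W _ hf hs]

/-- Each receiver sees its own output only, so the error probability depends on the channel only
through its conditional marginals. -/
lemma Code.errorProb_congr {W V : Kernel (X₁ × X₂ × X₃) (Y₁ × Y₂ × Y₃)} [IsMarkovKernel W]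
    [IsMarkovKernel V] (h : SameMarginals W V) : c.errorProb V = c.errorProb W := by
  obtain ⟨h₁, h₂, h₃⟩ := h
  have hd₁ := c.measurable_dec₁
  have hd₂ := c.measurable_dec₂
  have hd₃ := c.measurable_dec₃
  simp only [Kernel.fst_eq, Kernel.snd_eq,
    ← Kernel.map_comp_right _ measurable_snd measurable_fst,
    ← Kernel.map_comp_right _ measurable_snd measurable_snd] at h₁ h₂ h₃
  rw [errorProb, errorProb]
  refine congrArg₂ max ?_ (congrArg₂ max ?_ ?_)
  · exact c.law_preimage_congr measurable_fst h₁ (s := {p | c.dec₁ p.2 ≠ p.1.1})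
      (measurableSet_eq_fun (by fun_prop) (by fun_prop)).compl
  · exact c.law_preimage_congr (by fun_prop) h₂ (s := {p | c.dec₂ p.2 ≠ p.1.2.1})
      (measurableSet_eq_fun (by fun_prop) (by fun_prop)).compl
  · exact c.law_preimage_congr (by fun_prop) h₃ (s := {p | c.dec₃ p.2 ≠ p.1.2.2})
      (measurableSet_eq_fun (by fun_prop) (by fun_prop)).compl

/-- The event that all three messages are decoded correctly. -/
def Code.correct : Set ((Fin M₁ × Fin M₂ × Fin M₃) × (Fin N → Y₁ × Y₂ × Y₃)) :=
  {p | c.dec₁ (fun t => (p.2 t).1) = p.1.1 ∧ c.dec₂ (fun t => (p.2 t).2.1) = p.1.2.1 ∧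
    c.dec₃ (fun t => (p.2 t).2.2) = p.1.2.2}

lemma Code.law_compl_correct_le (V : Kernel (X₁ × X₂ × X₃) (Y₁ × Y₂ × Y₃)) :
    c.law V c.correctᶜ ≤ 3 * c.errorProb V := by
  have hsub : c.correctᶜ ⊆ {p | c.dec₁ (fun t => (p.2 t).1) ≠ p.1.1} ∪
      ({p | c.dec₂ (fun t => (p.2 t).2.1) ≠ p.1.2.1} ∪
        {p | c.dec₃ (fun t => (p.2 t).2.2) ≠ p.1.2.2}) := by
    intro p hp
    simpa only [correct, Set.mem_compl_iff, Set.mem_union, Set.mem_ofPred_eq, not_and_or] using hp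
  calc c.law V c.correctᶜ
      ≤ c.errorProb V + (c.errorProb V + c.errorProb V) := by
        refine (measure_mono hsub).trans ((measure_union_le _ _).trans ?_)
        grw [measure_union_le]
        exact add_le_add (le_max_left _ _) (add_le_add (le_max_of_le_right (le_max_left _ _))
          (le_max_of_le_right (le_max_right _ _)))
    _ = 3 * c.errorProb V := by ring

variable [NeZero M₁] [NeZero M₂] [NeZero M₃] [NeZero N]

/-- The change of measure from the channel to the test channel `Q`. -/
lemma Code.log_le_klDiv_add [MeasurableSpace.CountableOrCountablyGenerated (X₁ × X₂ × X₃) Z]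
    (V : Kernel (X₁ × X₂ × X₃) (Y₁ × Y₂ × Y₃)) [IsMarkovKernel V] {f : Y₁ × Y₂ × Y₃ → Z}
    (hf : Measurable f) (Q : Kernel (X₁ × X₂ × X₃) Z) [IsMarkovKernel Q]
    {S : Set ((Fin M₁ × Fin M₂ × Fin M₃) × (Fin N → Z))} (hS : MeasurableSet S)
    (hcorrect : c.correct ⊆ {p | (p.1, fun t => f (p.2 t)) ∈ S}) {K : ℕ} (hK : K ≠ 0)
    (hQ : K * blockLaw Q c.input S ≤ 1) :
    ENNReal.ofReal (Real.log K) ≤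
      N * klDiv (empiricalLaw c.input ⊗ₘ V.map f) (empiricalLaw c.input ⊗ₘ Q) + 1 +
        ENNReal.ofReal (Real.log K) * (3 * c.errorProb V) := by
  have := Kernel.IsMarkovKernel.map V hf
  have herr : blockLaw (V.map f) c.input Sᶜ ≤ 3 * c.errorProb V := by
    rw [blockLaw_map V _ hf hS.compl]
    exact (measure_mono (Set.compl_subset_compl.2 hcorrect)).trans (c.law_compl_correct_le V)
  grw [← herr, ← klDiv_blockLaw]
  exact log_le_klDiv_add_of_mul_measure_le_one hS (by exact_mod_cast Nat.one_le_iff_ne_zero.2 hK)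
    (by rwa [ENNReal.ofReal_natCast])

end Converse

section Rates

lemma floor_two_rpow_pos {r : ℝ} (hr : 0 ≤ r) : 0 < ⌊(2 : ℝ) ^ r⌋₊ :=
  Nat.floor_pos.2 (Real.one_le_rpow one_le_two hr)

lemma log_floor_two_rpow_mem_Icc {r : ℝ} (hr : 0 ≤ r) :
    Real.log ⌊(2 : ℝ) ^ r⌋₊ ∈ Set.Icc (r * Real.log 2 - 1) (r * Real.log 2) := by
  have hone : (1 : ℝ) ≤ ⌊(2 : ℝ) ^ r⌋₊ := by exact_mod_cast floor_two_rpow_pos hr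
  have hle : (2 : ℝ) ^ r ≤ 2 * ⌊(2 : ℝ) ^ r⌋₊ := by
    linarith [Nat.lt_floor_add_one ((2 : ℝ) ^ r)]
  have hlog := Real.log_le_log (by positivity) hle
  rw [Real.log_mul two_ne_zero (by positivity)] at hlog
  rw [← Real.log_rpow two_pos]
  exact ⟨by linarith [Real.log_two_lt_d9],
    Real.log_le_log (by positivity) (Nat.floor_le (by positivity))⟩

lemma ofReal_rate_le {N : ℕ} (hN : N ≠ 0) {L r r' : ℝ} (hrr' : r ≤ r') (hL : N * r - 3 ≤ L)
    (hL' : L ≤ N * r) {D ε : ℝ≥0∞} (h : ENNReal.ofReal L ≤ N * D + 1 + ENNReal.ofReal L * ε) :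
    ENNReal.ofReal r ≤ D + (4 * (N : ℝ≥0∞)⁻¹ + ENNReal.ofReal r' * ε) := by
  have hN0 : (N : ℝ≥0∞) ≠ 0 := by exact_mod_cast hN
  have hNtop : (N : ℝ≥0∞) ≠ ⊤ := ENNReal.natCast_ne_top N
  refine (ENNReal.mul_le_mul_iff_right hN0 hNtop).1 ?_
  calc (N : ℝ≥0∞) * ENNReal.ofReal r = ENNReal.ofReal (N * r) := by
        rw [ENNReal.ofReal_mul (by positivity), ENNReal.ofReal_natCast]
    _ ≤ ENNReal.ofReal (L + 3) := ENNReal.ofReal_le_ofReal (by linarith)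
    _ ≤ ENNReal.ofReal L + ENNReal.ofReal 3 := ENNReal.ofReal_add_le
    _ ≤ N * D + 1 + ENNReal.ofReal (N * r') * ε + 3 := by
        refine add_le_add (h.trans ?_) (by norm_num)
        gcongr
        exact hL'.trans (by gcongr)
    _ = N * D + (N * (N : ℝ≥0∞)⁻¹ * 4 + N * (ENNReal.ofReal r' * ε)) := by
        rw [ENNReal.mul_inv_cancel hN0 hNtop, ENNReal.ofReal_mul (by positivity),
          ENNReal.ofReal_natCast]
        ring
    _ = _ := by ring

end Rates

section TestBounds

/-- The rate bound `r log 2 ≤ D(P ⊗ V ‖ P ⊗ Q) + δ`, in nats, for all test channels `Q ∈ 𝒬`. -/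
def TestBound {X Z : Type*} [MeasurableSpace X] [MeasurableSpace Z] (P : Measure X)
    (V : Kernel X Z) (𝒬 : Set (Kernel X Z)) (r : ℝ) (δ : ℝ≥0∞) : Prop :=
  ∀ Q ∈ 𝒬, ENNReal.ofReal (r * Real.log 2) ≤ klDiv (P ⊗ₘ V) (P ⊗ₘ Q) + δ

variable {X₁ X₂ X₃ Y₁ Y₂ Y₃ : Type*}
  [MeasurableSpace X₁] [MeasurableSpace X₂] [MeasurableSpace X₃]
  [MeasurableSpace Y₁] [MeasurableSpace Y₂] [MeasurableSpace Y₃]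

/-- The five rate bounds up to a slack `δ`, in nats, with the divergences from all test channels
in place of the mutual informations. -/
structure TestBounds (P : Measure (X₁ × X₂ × X₃)) (V : Kernel (X₁ × X₂ × X₃) (Y₁ × Y₂ × Y₃))
    (R : ℝ × ℝ × ℝ) (δ : ℝ≥0∞) : Prop where
  rate₁ : TestBound P (V.map fun y => y.1) (channelsThrough fun _ => ()) R.1 δ
  rate₂ : TestBound P (V.map fun y => y.2.1) (channelsThrough Prod.fst) R.2.1 δ
  rate₃ : TestBound P (V.map fun y => y.2.2) (channelsThrough fun x => (x.1, x.2.1)) R.2.2 δ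
  rate₂₃ : TestBound P (V.map fun y => y.2) testChannels₂₃ (R.2.1 + R.2.2) δ
  rate₁₂₃ : TestBound P V testChannels₁₂₃ (R.1 + R.2.1 + R.2.2) δ

variable {Z : Type*} [MeasurableSpace Z] {N M₁ M₂ M₃ : ℕ} [NeZero N] [NeZero M₁] [NeZero M₂]
  [NeZero M₃] (c : Code X₁ X₂ X₃ Y₁ Y₂ Y₃ N M₁ M₂ M₃)
  (V : Kernel (X₁ × X₂ × X₃) (Y₁ × Y₂ × Y₃)) [IsMarkovKernel V]

lemma Code.testBound [MeasurableSpace.CountableOrCountablyGenerated (X₁ × X₂ × X₃) Z]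
    {f : Y₁ × Y₂ × Y₃ → Z} (hf : Measurable f) {𝒬 : Set (Kernel (X₁ × X₂ × X₃) Z)}
    {S : Set ((Fin M₁ × Fin M₂ × Fin M₃) × (Fin N → Z))} (hS : MeasurableSet S)
    (hcorrect : c.correct ⊆ {p | (p.1, fun t => f (p.2 t)) ∈ S}) {K : ℕ} (hK : K ≠ 0)
    (h𝒬 : ∀ Q ∈ 𝒬, IsMarkovKernel Q ∧ K * blockLaw Q c.input S ≤ 1) {r r' : ℝ} (hrr' : r ≤ r')
    (hlog : Real.log K ∈ Set.Icc (N * r * Real.log 2 - 3) (N * r * Real.log 2)) :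
    TestBound (empiricalLaw c.input) (V.map f) 𝒬 r (4 * (N : ℝ≥0∞)⁻¹ +
      ENNReal.ofReal (r' * Real.log 2) * (3 * c.errorProb V)) := by
  intro Q hQ
  obtain ⟨_, hQS⟩ := h𝒬 Q hQ
  rw [mul_assoc] at hlog
  exact ofReal_rate_le (NeZero.ne N) (by gcongr) hlog.1 hlog.2
    (c.log_le_klDiv_add V hf Q hS hcorrect hK hQS)

lemma Code.testBounds [MeasurableSpace.CountablyGenerated Y₁]
    [MeasurableSpace.CountablyGenerated Y₂] [MeasurableSpace.CountablyGenerated Y₃] {R : ℝ × ℝ × ℝ}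
    (hR₁ : 0 ≤ R.1) (hR₂ : 0 ≤ R.2.1) (hR₃ : 0 ≤ R.2.2)
    (hM₁ : Real.log M₁ ∈ Set.Icc (N * R.1 * Real.log 2 - 1) (N * R.1 * Real.log 2))
    (hM₂ : Real.log M₂ ∈ Set.Icc (N * R.2.1 * Real.log 2 - 1) (N * R.2.1 * Real.log 2))
    (hM₃ : Real.log M₃ ∈ Set.Icc (N * R.2.2 * Real.log 2 - 1) (N * R.2.2 * Real.log 2)) :
    TestBounds (empiricalLaw c.input) V R (4 * (N : ℝ≥0∞)⁻¹ +
      ENNReal.ofReal ((R.1 + R.2.1 + R.2.2) * Real.log 2) * (3 * c.errorProb V)) := by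
  have hd₁ := c.measurable_dec₁
  have hd₂ := c.measurable_dec₂
  have hd₃ := c.measurable_dec₃
  have hlog₂₃ : Real.log ((M₂ * M₃ : ℕ) : ℝ) = Real.log M₂ + Real.log M₃ := by
    rw [Nat.cast_mul, Real.log_mul (NeZero.ne _) (NeZero.ne _)]
  have hlog₁₂₃ : Real.log ((M₁ * M₂ * M₃ : ℕ) : ℝ) = Real.log M₁ + Real.log M₂ + Real.log M₃ := by
    rw [mul_assoc, Nat.cast_mul, Real.log_mul (NeZero.ne _) (NeZero.ne _), hlog₂₃, add_assoc]
  simp only [Set.mem_Icc] at hM₁ hM₂ hM₃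
  refine ⟨?_, ?_, ?_, ?_, ?_⟩
  · refine c.testBound V measurable_fst (S := {p | c.dec₁ p.2 = p.1.1})
      (measurableSet_eq_fun (by fun_prop) (by fun_prop)) (fun p hp => hp.1) (NeZero.ne M₁)
      (fun Q hQ => ⟨hQ.1, c.mul_blockLaw_guess₁_le hQ hd₁⟩) (by linarith) ?_
    constructor <;> linarith
  · refine c.testBound V (f := fun y => y.2.1) (by fun_prop) (S := {p | c.dec₂ p.2 = p.1.2.1})
      (measurableSet_eq_fun (by fun_prop) (by fun_prop)) (fun p hp => hp.2.1) (NeZero.ne M₂)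
      (fun Q hQ => ⟨hQ.1, c.mul_blockLaw_correct₂_le hQ⟩) (by linarith) ?_
    constructor <;> linarith
  · refine c.testBound V (f := fun y => y.2.2) (by fun_prop) (S := {p | c.dec₃ p.2 = p.1.2.2})
      (measurableSet_eq_fun (by fun_prop) (by fun_prop)) (fun p hp => hp.2.2) (NeZero.ne M₃)
      (fun Q hQ => ⟨hQ.1, c.mul_blockLaw_correct₃_le hQ⟩) (by linarith) ?_
    constructor <;> linarith
  · refine c.testBound V measurable_snd
      (S := {p | c.dec₂ (fun t => (p.2 t).1) = p.1.2.1 ∧ c.dec₃ (fun t => (p.2 t).2) = p.1.2.2})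
      ((measurableSet_eq_fun (by fun_prop) (by fun_prop)).inter
        (measurableSet_eq_fun (by fun_prop) (by fun_prop))) (fun p hp => hp.2) (NeZero.ne (M₂ * M₃))
      (fun Q hQ => ⟨hQ.1.1, by exact_mod_cast c.mul_blockLaw_correct₂₃_le hQ⟩) (by linarith) ?_
    rw [hlog₂₃]
    constructor <;> linarith
  · have h := c.testBound V measurable_id (𝒬 := testChannels₁₂₃) (r := R.1 + R.2.1 + R.2.2)
      (S := {p | (c.dec₁ (fun t => (p.2 t).1) = p.1.1 ∧ c.dec₂ (fun t => (p.2 t).2.1) = p.1.2.1) ∧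
        c.dec₃ (fun t => (p.2 t).2.2) = p.1.2.2})
      (((measurableSet_eq_fun (by fun_prop) (by fun_prop)).inter
        (measurableSet_eq_fun (by fun_prop) (by fun_prop))).inter
          (measurableSet_eq_fun (by fun_prop) (by fun_prop))) (fun p hp => and_assoc.2 hp)
      (NeZero.ne (M₁ * M₂ * M₃))
      (fun Q hQ => ⟨hQ.1.1, by exact_mod_cast c.mul_blockLaw_correct₁₂₃_le hQ⟩) le_rfl
      (by rw [hlog₁₂₃]; constructor <;> linarith)
    rwa [Kernel.map_id] at h

end TestBounds

section Achievable

variable {X₁ X₂ X₃ Y₁ Y₂ Y₃ : Type*}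
  [MeasurableSpace X₁] [MeasurableSpace X₂] [MeasurableSpace X₃]
  [MeasurableSpace Y₁] [MeasurableSpace Y₂] [MeasurableSpace Y₃]

lemma exists_testBounds [MeasurableSpace.CountablyGenerated Y₁]
    [MeasurableSpace.CountablyGenerated Y₂] [MeasurableSpace.CountablyGenerated Y₃]
    (W : Kernel (X₁ × X₂ × X₃) (Y₁ × Y₂ × Y₃)) [IsMarkovKernel W]
    {R : ℝ × ℝ × ℝ} (hR : R ∈ capacityRegion W) :
    ∃ (P : ℕ → Measure (X₁ × X₂ × X₃)) (δ : ℕ → ℝ≥0∞), Tendsto δ atTop (𝓝 0) ∧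
      ∀ N ≠ 0, IsProbabilityMeasure (P N) ∧
        ∀ (V : Kernel (X₁ × X₂ × X₃) (Y₁ × Y₂ × Y₃)) [IsMarkovKernel V],
          SameMarginals W V → TestBounds (P N) V R (δ N) := by
  obtain ⟨hR₁, hR₂, hR₃, c, hc⟩ := hR
  refine ⟨fun N => empiricalLaw (c N).input, fun N => 4 * (N : ℝ≥0∞)⁻¹ +
    ENNReal.ofReal ((R.1 + R.2.1 + R.2.2) * Real.log 2) * (3 * (c N).errorProb W), ?_, ?_⟩
  · have hinv : Tendsto (fun N : ℕ => 4 * (N : ℝ≥0∞)⁻¹) atTop (𝓝 (4 * 0)) :=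
      ENNReal.Tendsto.const_mul ENNReal.tendsto_inv_nat_nhds_zero (Or.inr (by simp))
    have herr := ENNReal.Tendsto.const_mul (a := ENNReal.ofReal ((R.1 + R.2.1 + R.2.2) *
      Real.log 2)) (ENNReal.Tendsto.const_mul (a := 3) hc (Or.inr (by simp)))
      (Or.inr ENNReal.ofReal_ne_top)
    simpa using hinv.add herr
  · intro N hN
    have hNR₁ : 0 ≤ N * R.1 := by positivity
    have hNR₂ : 0 ≤ N * R.2.1 := by positivity
    have hNR₃ : 0 ≤ N * R.2.2 := by positivity
    have : NeZero N := ⟨hN⟩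
    have : NeZero ⌊(2 : ℝ) ^ (N * R.1)⌋₊ := ⟨(floor_two_rpow_pos hNR₁).ne'⟩
    have : NeZero ⌊(2 : ℝ) ^ (N * R.2.1)⌋₊ := ⟨(floor_two_rpow_pos hNR₂).ne'⟩
    have : NeZero ⌊(2 : ℝ) ^ (N * R.2.2)⌋₊ := ⟨(floor_two_rpow_pos hNR₃).ne'⟩
    refine ⟨isProbabilityMeasure_empiricalLaw _, fun V _ hV => ?_⟩
    have hbounds := (c N).testBounds V hR₁ hR₂ hR₃ (log_floor_two_rpow_mem_Icc hNR₁)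
      (log_floor_two_rpow_mem_Icc hNR₂) (log_floor_two_rpow_mem_Icc hNR₃)
    rwa [(c N).errorProb_congr hV] at hbounds

lemma ofReal_le_of_mul_log_two_le {a b d : ℝ} (hd : 0 ≤ d) (hab : a ≤ b - d) {I δ : ℝ≥0∞}
    (h : ENNReal.ofReal (b * Real.log 2) ≤ I * ENNReal.ofReal (Real.log 2) + δ)
    (hδ : δ ≤ ENNReal.ofReal (d * Real.log 2)) : ENNReal.ofReal a ≤ I := by
  have hlog := Real.log_pos one_lt_two
  refine (ENNReal.mul_le_mul_iff_left ofReal_log_two_ne_zero ENNReal.ofReal_ne_top).1 ?_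
  calc ENNReal.ofReal a * ENNReal.ofReal (Real.log 2)
      = ENNReal.ofReal (a * Real.log 2) := (ENNReal.ofReal_mul' hlog.le).symm
    _ ≤ ENNReal.ofReal (b * Real.log 2 - d * Real.log 2) := by
        rw [← sub_mul]
        gcongr
    _ = ENNReal.ofReal (b * Real.log 2) - ENNReal.ofReal (d * Real.log 2) :=
        ENNReal.ofReal_sub _ (by positivity)
    _ ≤ I * ENNReal.ofReal (Real.log 2) := tsub_le_iff_right.2 (h.trans (by gcongr))

end Achievable

section ClosureBound

variable {X₁ X₂ X₃ Y₁ Y₂ Y₃ : Type*}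
  [MeasurableSpace X₁] [MeasurableSpace X₂] [MeasurableSpace X₃]
  [MeasurableSpace Y₁] [MeasurableSpace Y₂] [MeasurableSpace Y₃]
  [StandardBorelSpace X₂] [Nonempty X₂] [StandardBorelSpace X₃] [Nonempty X₃]
  [StandardBorelSpace Y₂] [Nonempty Y₂] [StandardBorelSpace Y₃] [Nonempty Y₃]

lemma TestBounds.rateBounds {P : Measure (X₁ × X₂ × X₃)} [IsProbabilityMeasure P]
    {V : Kernel (X₁ × X₂ × X₃) (Y₁ × Y₂ × Y₃)} [IsMarkovKernel V] {R : ℝ × ℝ × ℝ} {δ : ℝ≥0∞}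
    (h : TestBounds P V R δ) {d : ℝ} (hd : 0 ≤ d) (hδ : δ ≤ ENNReal.ofReal (d * Real.log 2)) :
    RateBounds P V (R.1 - d, R.2.1 - d, R.2.2 - d) := by
  constructor
  · obtain ⟨Q, hQ, heq⟩ := exists_klDiv_eq_mutualInfo P V measurable_fst
    exact ofReal_le_of_mul_log_two_le hd le_rfl (heq ▸ h.rate₁ Q hQ) hδ
  · obtain ⟨Q, hQ, heq⟩ := exists_klDiv_eq_condMutualInfo P V (f := fun y => y.2.1) (by fun_prop)
      measurable_fst measurable_snd measurable_id fun _ => rfl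
    exact ofReal_le_of_mul_log_two_le hd le_rfl (heq ▸ h.rate₂ Q hQ) hδ
  · obtain ⟨Q, hQ, heq⟩ := exists_klDiv_eq_condMutualInfo P V (f := fun y => y.2.2) (by fun_prop)
      (g := fun x => (x.1, x.2.1)) (by fun_prop) (h := fun x => x.2.2) (by fun_prop)
      (k := fun q => (q.1.1, q.1.2, q.2)) (by fun_prop) fun _ => rfl
    exact ofReal_le_of_mul_log_two_le hd le_rfl (heq ▸ h.rate₃ Q hQ) hδ
  · obtain ⟨Q, hQ, heq⟩ := exists_testChannel₂₃_klDiv_eq P V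
    exact ofReal_le_of_mul_log_two_le hd (by simp only; linarith) (heq ▸ h.rate₂₃ Q hQ) hδ
  · obtain ⟨Q, hQ, heq⟩ := exists_testChannel₁₂₃_klDiv_eq P V
    exact ofReal_le_of_mul_log_two_le hd (by simp only; linarith) (heq ▸ h.rate₁₂₃ Q hQ) hδ

theorem capacityRegion_subset_closure_outerRegion [MeasurableSpace.CountablyGenerated Y₁]
    (W : Kernel (X₁ × X₂ × X₃) (Y₁ × Y₂ × Y₃)) [IsMarkovKernel W] :
    capacityRegion W ⊆ closure (outerRegion W) := by
  intro R hR
  obtain ⟨P, δ, hδ, h⟩ := exists_testBounds W hR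
  have hlim : Tendsto (fun d : ℝ => (R.1 - d, R.2.1 - d, R.2.2 - d)) (𝓝[>] 0) (𝓝 R) := by
    have hcont : Continuous fun d : ℝ => (R.1 - d, R.2.1 - d, R.2.2 - d) := by fun_prop
    simpa using (hcont.tendsto 0).mono_left nhdsWithin_le_nhds
  refine mem_closure_of_tendsto hlim ?_
  filter_upwards [self_mem_nhdsWithin] with d hd
  have hd_log : 0 < ENNReal.ofReal (d * Real.log 2) :=
    ENNReal.ofReal_pos.2 (mul_pos hd (Real.log_pos one_lt_two))
  obtain ⟨N, hδN, hN⟩ := ((hδ.eventually_le_const hd_log).and (eventually_ne_atTop 0)).exists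
  obtain ⟨hP, hV⟩ := h N hN
  exact ⟨P N, hP, fun V _ hVW => (hV V hVW).rateBounds (le_of_lt hd) hδN⟩

end ClosureBound

section Mixture

variable {X Y Z G : Type*} [MeasurableSpace X] [MeasurableSpace Y] [MeasurableSpace Z]

/-- The channel that acts as `Q` with probability `t` and ignores its input, with output law `q`,
with probability `1 - t`. -/
def mixture (t : ℝ) (Q : Kernel X Z) (q : Measure Z) : Kernel X Z where
  toFun x := ENNReal.ofReal t • Q x + ENNReal.ofReal (1 - t) • q
  measurable' := by
    refine Measure.measurable_of_measurable_coe _ fun s hs => ?_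
    simp only [Measure.add_apply, Measure.smul_apply, smul_eq_mul]
    exact ((Kernel.measurable_coe Q hs).const_mul _).add_const _

lemma mixture_apply (t : ℝ) (Q : Kernel X Z) (q : Measure Z) (x : X) :
    mixture t Q q x = ENNReal.ofReal t • Q x + ENNReal.ofReal (1 - t) • q := rfl

lemma isMarkovKernel_mixture {t : ℝ} (ht : t ∈ Set.Icc 0 1) (Q : Kernel X Z) [IsMarkovKernel Q]
    (q : Measure Z) [IsProbabilityMeasure q] : IsMarkovKernel (mixture t Q q) := by
  refine ⟨fun x => ⟨?_⟩⟩
  simp only [mixture_apply, Measure.add_apply, Measure.smul_apply, measure_univ, smul_eq_mul,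
    mul_one, ← ENNReal.ofReal_add ht.1 (sub_nonneg.2 ht.2), add_sub_cancel, ENNReal.ofReal_one]

lemma mixture_map (t : ℝ) (Q : Kernel X Y) (q : Measure Y) {f : Y → Z} (hf : Measurable f) :
    (mixture t Q q).map f = mixture t (Q.map f) (q.map f) := by
  ext1 x
  simp only [Kernel.map_apply _ hf, mixture_apply, Measure.map_add _ _ hf, Measure.map_smul]

lemma le_smul_mixture {t : ℝ} (ht : 0 < t) (Q : Kernel X Z) (q : Measure Z) (x : X) :
    Q x ≤ ENNReal.ofReal t⁻¹ • mixture t Q q x := by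
  rw [mixture_apply, smul_add, smul_smul, ← ENNReal.ofReal_mul (inv_nonneg.2 ht.le),
    inv_mul_cancel₀ ht.ne', ENNReal.ofReal_one, one_smul]
  exact Measure.le_add_right le_rfl

lemma le_smul_mixture_right {t : ℝ} (ht : t < 1) (Q : Kernel X Z) (q : Measure Z) (x : X) :
    q ≤ ENNReal.ofReal (1 - t)⁻¹ • mixture t Q q x := by
  have ht' : 0 < 1 - t := sub_pos.2 ht
  rw [mixture_apply, smul_add, smul_smul _ _ q, ← ENNReal.ofReal_mul (inv_nonneg.2 ht'.le),
    inv_mul_cancel₀ ht'.ne', ENNReal.ofReal_one, one_smul]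
  exact Measure.le_add_left le_rfl

/-- A class of channels that is closed under mixing its members with channels of constant output
law. -/
def IsMixtureClosed (𝒬 : Set (Kernel X Z)) : Prop :=
  ∀ Q ∈ 𝒬, ∀ (q : Measure Z) [IsProbabilityMeasure q], ∀ t ∈ Set.Icc (0 : ℝ) 1, mixture t Q q ∈ 𝒬

lemma isMixtureClosed_channelsThrough (g : X → G) :
    IsMixtureClosed (channelsThrough g : Set (Kernel X Z)) := by
  rintro Q ⟨_, hQg⟩ q _ t ht
  refine ⟨isMarkovKernel_mixture ht Q q, fun a b hab => ?_⟩
  rw [mixture_apply, mixture_apply, hQg hab]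

lemma IsMixtureClosed.preimage_map {𝒬 : Set (Kernel X Z)} (h𝒬 : IsMixtureClosed 𝒬) {f : Y → Z}
    (hf : Measurable f) : IsMixtureClosed {Q : Kernel X Y | Q.map f ∈ 𝒬} := by
  intro Q hQ q _ t ht
  have := Measure.isProbabilityMeasure_map (μ := q) hf.aemeasurable
  rw [Set.mem_ofPred_eq, mixture_map t Q q hf]
  exact h𝒬 _ hQ _ t ht

lemma IsMixtureClosed.inter {𝒬 𝒬' : Set (Kernel X Z)} (h𝒬 : IsMixtureClosed 𝒬)
    (h𝒬' : IsMixtureClosed 𝒬') : IsMixtureClosed (𝒬 ∩ 𝒬') :=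
  fun Q hQ q _ t ht => ⟨h𝒬 Q hQ.1 q t ht, h𝒬' Q hQ.2 q t ht⟩

variable {X₁ X₂ X₃ Y₁ Y₂ Y₃ : Type*}
  [MeasurableSpace X₁] [MeasurableSpace X₂] [MeasurableSpace X₃]
  [MeasurableSpace Y₁] [MeasurableSpace Y₂] [MeasurableSpace Y₃]

lemma isMixtureClosed_testChannels₂₃ :
    IsMixtureClosed (testChannels₂₃ : Set (Kernel (X₁ × X₂ × X₃) (Y₂ × Y₃))) := by
  simp only [testChannels₂₃, Kernel.fst_eq]
  exact (isMixtureClosed_channelsThrough _).inter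
    ((isMixtureClosed_channelsThrough _).preimage_map measurable_fst)

lemma isMixtureClosed_testChannels₁₂₃ :
    IsMixtureClosed (testChannels₁₂₃ : Set (Kernel (X₁ × X₂ × X₃) (Y₁ × Y₂ × Y₃))) := by
  simp only [testChannels₁₂₃, Kernel.fst_eq]
  exact (isMixtureClosed_channelsThrough _).inter
    (((isMixtureClosed_channelsThrough _).preimage_map (by fun_prop)).inter
      ((isMixtureClosed_channelsThrough _).preimage_map measurable_fst))

end Mixture

section FiniteInput

variable {X Z : Type*} [MeasurableSpace X] [MeasurableSpace Z]

lemma compProd_le_smul_compProd {μ : Measure X} [SFinite μ] {κ η : Kernel X Z} [IsSFiniteKernel κ]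
    [IsSFiniteKernel η] {b : ℝ≥0∞} (h : ∀ x, κ x ≤ b • η x) : μ ⊗ₘ κ ≤ b • (μ ⊗ₘ η) := by
  refine Measure.le_iff.2 fun s hs => ?_
  rw [Measure.smul_apply, Measure.compProd_apply hs, Measure.compProd_apply hs, smul_eq_mul,
    ← lintegral_const_mul _ (Kernel.measurable_kernel_prodMk_left hs)]
  exact lintegral_mono fun x => h x _

lemma klDiv_ne_top_of_le_smul {μ ν : Measure Z} [IsProbabilityMeasure μ] [IsProbabilityMeasure ν]
    {b : ℝ≥0∞} (hb : b ≠ ⊤) (h : μ ≤ b • ν) : klDiv μ ν ≠ ⊤ := by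
  rw [← ENNReal.ofReal_toReal hb] at h
  have hle := klDiv_le_add_of_le_smul (μ := μ) h
  rw [klDiv_self, zero_add] at hle
  exact ne_top_of_le_ne_top ENNReal.ofReal_ne_top hle

lemma klDiv_compProd_le_mixture_add {t : ℝ} (ht : t ∈ Set.Ioc 0 1) (P : Measure X)
    [IsProbabilityMeasure P] (V Q : Kernel X Z) [IsMarkovKernel V] [IsMarkovKernel Q]
    (q : Measure Z) [IsProbabilityMeasure q] :
    klDiv (P ⊗ₘ V) (P ⊗ₘ mixture t Q q) ≤
      klDiv (P ⊗ₘ V) (P ⊗ₘ Q) + ENNReal.ofReal (Real.log t⁻¹) := by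
  have := isMarkovKernel_mixture (Set.Ioc_subset_Icc_self ht) Q q
  exact klDiv_le_add_of_le_smul (compProd_le_smul_compProd (le_smul_mixture ht.1 Q q))

variable [Finite X] [MeasurableSingletonClass X]

lemma le_card_smul_comp_uniformOn (V : Kernel X Z) (x : X) :
    V x ≤ (Nat.card X : ℝ≥0∞) • (V ∘ₘ uniformOn Set.univ) := by
  have := Fintype.ofFinite X
  have : Nonempty X := ⟨x⟩
  refine Measure.le_iff.2 fun s hs => ?_
  rw [Measure.smul_apply, Measure.bind_apply hs V.aemeasurable, lintegral_uniformOn_univ,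
    Nat.card_eq_fintype_card, smul_eq_mul,
    ENNReal.mul_inv_cancel_left (by simp) (ENNReal.natCast_ne_top _)]
  exact Finset.single_le_sum (f := fun y => V y s) (fun _ _ => zero_le) (Finset.mem_univ x)

lemma klDiv_mixture_ne_top {t : ℝ} (ht : t ∈ Set.Ico 0 1) (V Q : Kernel X Z) [IsMarkovKernel V]
    [IsMarkovKernel Q] (x : X) :
    klDiv (V x) (mixture t Q (V ∘ₘ uniformOn Set.univ) x) ≠ ⊤ := by
  have : Nonempty X := ⟨x⟩
  have := isMarkovKernel_mixture (Set.Ico_subset_Icc_self ht) Q (V ∘ₘ uniformOn Set.univ)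
  refine klDiv_ne_top_of_le_smul (b := Nat.card X * ENNReal.ofReal (1 - t)⁻¹)
    (ENNReal.mul_ne_top (ENNReal.natCast_ne_top _) ENNReal.ofReal_ne_top) ?_
  rw [mul_smul]
  grw [← le_smul_mixture_right ht.2]
  exact le_card_smul_comp_uniformOn V x

variable {ι : Type*} {u : Filter ι} [u.NeBot] {P : ι → Measure X} {P' : Measure X}
  {δ : ι → ℝ≥0∞}

lemma le_lintegral_of_tendsto (hP : ∀ x, Tendsto (fun n => P n {x}) u (𝓝 (P' {x})))
    (hδ : Tendsto δ u (𝓝 0)) {f : X → ℝ≥0∞} (hf : ∀ x, f x ≠ ⊤) {r : ℝ≥0∞}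
    (h : ∀ᶠ n in u, r ≤ ∫⁻ x, f x ∂P n + δ n) : r ≤ ∫⁻ x, f x ∂P' := by
  have := Fintype.ofFinite X
  have hlim : Tendsto (fun n => ∑ x, f x * P n {x} + δ n) u (𝓝 (∑ x, f x * P' {x} + 0)) :=
    (tendsto_finsetSum _ fun x _ =>
      ENNReal.Tendsto.const_mul (hP x) (Or.inr (hf x))).add hδ
  simp only [lintegral_fintype] at h ⊢
  simpa only [add_zero] using ge_of_tendsto hlim h

/-- The divergence from `Q` itself may be infinite, hence discontinuous in the input law; mixing
`Q` with the average output law of `V` makes it finite at every input, at a small cost. -/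
lemma TestBound.of_tendsto [∀ n, IsFiniteMeasure (P n)] [IsProbabilityMeasure P']
    (hP : ∀ x, Tendsto (fun n => P n {x}) u (𝓝 (P' {x}))) (hδ : Tendsto δ u (𝓝 0))
    {V : Kernel X Z} [IsMarkovKernel V] {𝒬 : Set (Kernel X Z)}
    (h𝒬 : ∀ Q ∈ 𝒬, IsMarkovKernel Q) (h𝒬mix : IsMixtureClosed 𝒬) {r : ℝ}
    (h : ∀ᶠ n in u, TestBound (P n) V 𝒬 r (δ n)) : TestBound P' V 𝒬 r 0 := by
  intro Q hQ
  have := h𝒬 Q hQ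
  have : Nonempty X := nonempty_of_isProbabilityMeasure P'
  have hlog : Tendsto (fun t : ℝ => klDiv (P' ⊗ₘ V) (P' ⊗ₘ Q) + ENNReal.ofReal (Real.log t⁻¹))
      (𝓝[<] 1) (𝓝 (klDiv (P' ⊗ₘ V) (P' ⊗ₘ Q) + 0)) := by
    have hcont : ContinuousAt (fun t : ℝ => ENNReal.ofReal (Real.log t⁻¹)) 1 :=
      ENNReal.continuous_ofReal.continuousAt.comp
        ((continuousAt_inv₀ one_ne_zero).log (inv_ne_zero one_ne_zero))
    simpa using tendsto_const_nhds.add (hcont.tendsto.mono_left nhdsWithin_le_nhds)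
  refine ge_of_tendsto hlog ?_
  filter_upwards [Ioo_mem_nhdsLT (zero_lt_one (α := ℝ))] with t ht
  have hmix := h𝒬mix Q hQ (V ∘ₘ uniformOn Set.univ) t (Set.Ioo_subset_Icc_self ht)
  have := h𝒬 _ hmix
  grw [← klDiv_compProd_le_mixture_add (Set.Ioo_subset_Ioc_self ht) P' V Q
    (V ∘ₘ uniformOn Set.univ), klDiv_compProd_right]
  refine le_lintegral_of_tendsto hP hδ (klDiv_mixture_ne_top (Set.Ioo_subset_Ico_self ht) V Q)
    (h.mono fun n hn => ?_)
  rw [← klDiv_compProd_right]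
  exact hn _ hmix

/-- Compactness of the simplex of probability measures on a finite set. -/
lemma exists_tendsto_measure_singleton (P : ι → Measure X) [∀ n, IsProbabilityMeasure (P n)]
    (u : Ultrafilter ι) : ∃ P' : Measure X, IsProbabilityMeasure P' ∧
      ∀ x, Tendsto (fun n => P n {x}) u (𝓝 (P' {x})) := by
  let _ : TopologicalSpace X := ⊥
  have : DiscreteTopology X := ⟨rfl⟩
  let p (n : ι) : ProbabilityMeasure X := ⟨P n, inferInstance⟩
  obtain ⟨p', -, hp'⟩ := isCompact_univ.ultrafilter_le_nhds (u.map p) (by simp)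
  refine ⟨p', inferInstance, fun x => ?_⟩
  exact ProbabilityMeasure.tendsto_measure_of_null_frontier_of_tendsto' (μs := p) hp' (by simp)

end FiniteInput

section FiniteBound

variable {X₁ X₂ X₃ Y₁ Y₂ Y₃ : Type*}
  [MeasurableSpace X₁] [MeasurableSpace X₂] [MeasurableSpace X₃]
  [MeasurableSpace Y₁] [MeasurableSpace Y₂] [MeasurableSpace Y₃]
  [Finite X₁] [Finite X₂] [Finite X₃] [MeasurableSingletonClass X₁]

lemma TestBounds.of_tendsto [MeasurableSingletonClass X₂] [MeasurableSingletonClass X₃]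
    {ι : Type*} {u : Filter ι} [u.NeBot] {P : ι → Measure (X₁ × X₂ × X₃)}
    [∀ n, IsFiniteMeasure (P n)] {P' : Measure (X₁ × X₂ × X₃)} [IsProbabilityMeasure P']
    (hP : ∀ x, Tendsto (fun n => P n {x}) u (𝓝 (P' {x}))) {δ : ι → ℝ≥0∞} (hδ : Tendsto δ u (𝓝 0))
    {V : Kernel (X₁ × X₂ × X₃) (Y₁ × Y₂ × Y₃)} [IsMarkovKernel V] {R : ℝ × ℝ × ℝ}
    (h : ∀ᶠ n in u, TestBounds (P n) V R (δ n)) : TestBounds P' V R 0 := by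
  have := Kernel.IsMarkovKernel.map V (f := fun y => y.1) (by fun_prop)
  have := Kernel.IsMarkovKernel.map V (f := fun y => y.2.1) (by fun_prop)
  have := Kernel.IsMarkovKernel.map V (f := fun y => y.2.2) (by fun_prop)
  have := Kernel.IsMarkovKernel.map V (f := fun y => y.2) (by fun_prop)
  constructor
  · exact .of_tendsto hP hδ (fun Q hQ => hQ.1) (isMixtureClosed_channelsThrough _)
      (h.mono fun n hn => hn.rate₁)
  · exact .of_tendsto hP hδ (fun Q hQ => hQ.1) (isMixtureClosed_channelsThrough _)
      (h.mono fun n hn => hn.rate₂)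
  · exact .of_tendsto hP hδ (fun Q hQ => hQ.1) (isMixtureClosed_channelsThrough _)
      (h.mono fun n hn => hn.rate₃)
  · exact .of_tendsto hP hδ (fun Q hQ => hQ.1.1) isMixtureClosed_testChannels₂₃
      (h.mono fun n hn => hn.rate₂₃)
  · exact .of_tendsto hP hδ (fun Q hQ => hQ.1.1) isMixtureClosed_testChannels₁₂₃
      (h.mono fun n hn => hn.rate₁₂₃)

theorem capacityRegion_subset_outerRegion [StandardBorelSpace X₂] [Nonempty X₂]
    [StandardBorelSpace X₃] [Nonempty X₃] [MeasurableSpace.CountablyGenerated Y₁]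
    [StandardBorelSpace Y₂] [Nonempty Y₂] [StandardBorelSpace Y₃] [Nonempty Y₃]
    (W : Kernel (X₁ × X₂ × X₃) (Y₁ × Y₂ × Y₃)) [IsMarkovKernel W] :
    capacityRegion W ⊆ outerRegion W := by
  intro R hR
  obtain ⟨P, δ, hδ, h⟩ := exists_testBounds W hR
  have (n : ℕ) : IsProbabilityMeasure (P (n + 1)) := (h (n + 1) n.succ_ne_zero).1
  obtain ⟨P', hP', hlim⟩ := exists_tendsto_measure_singleton (fun n => P (n + 1)) (hyperfilter ℕ)
  have hδ' : Tendsto (fun n => δ (n + 1)) (hyperfilter ℕ) (𝓝 0) :=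
    (hδ.comp (tendsto_add_atTop_nat 1)).mono_left Nat.hyperfilter_le_atTop
  refine ⟨P', hP', fun V _ hVW => ?_⟩
  have hT : TestBounds P' V R 0 :=
    .of_tendsto hlim hδ' (.of_forall fun n => (h (n + 1) n.succ_ne_zero).2 V hVW)
  simpa using hT.rateBounds le_rfl zero_le

end FiniteBound

section Transport

variable {Ω Ω' α β β' γ : Type*} [MeasurableSpace Ω] [MeasurableSpace Ω'] [MeasurableSpace α]
  [MeasurableSpace β] [MeasurableSpace β'] [MeasurableSpace γ]

lemma mutualInfo_map (μ : Measure Ω) {Φ : Ω → Ω'} (hΦ : Measurable Φ) {A : Ω' → α} {B : Ω' → β}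
    (hA : Measurable A) (hB : Measurable B) :
    mutualInfo (μ.map Φ) A B = mutualInfo μ (fun ω => A (Φ ω)) (fun ω => B (Φ ω)) := by
  rw [mutualInfo, mutualInfo, Measure.map_map hA hΦ, Measure.map_map hB hΦ,
    Measure.map_map (hA.prodMk hB) hΦ]
  rfl

lemma condMutualInfo_map [StandardBorelSpace α] [Nonempty α] [StandardBorelSpace β] [Nonempty β]
    (μ : Measure Ω) [IsFiniteMeasure μ] {Φ : Ω → Ω'} (hΦ : Measurable Φ) {A : Ω' → α}
    {B : Ω' → β} {C : Ω' → γ} (hA : Measurable A) (hB : Measurable B) (hC : Measurable C) :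
    condMutualInfo (μ.map Φ) A B C =
      condMutualInfo μ (fun ω => A (Φ ω)) (fun ω => B (Φ ω)) (fun ω => C (Φ ω)) := by
  simp only [condMutualInfo, condDistrib, Measure.map_map hC hΦ,
    Measure.map_map (hC.prodMk (hA.prodMk hB)) hΦ, Measure.map_map (hC.prodMk hA) hΦ,
    Measure.map_map (hC.prodMk hB) hΦ]
  rfl

variable {A : Ω → α} {B : Ω → β} {g : β → β'} {g' : β' → β}

lemma mutualInfo_comp_right (μ : Measure Ω) [IsFiniteMeasure μ] (hA : Measurable A)
    (hB : Measurable B) (hg : Measurable g) (hg' : Measurable g')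
    (h : Function.LeftInverse g' g) :
    mutualInfo μ A (fun ω => g (B ω)) = mutualInfo μ A B := by
  have hjoint : μ.map (fun ω => (A ω, g (B ω))) =
      (μ.map fun ω => (A ω, B ω)).map (Prod.map id g) := by
    rw [Measure.map_map (by fun_prop) (by fun_prop)]; rfl
  have hprod : (μ.map A).prod (μ.map fun ω => g (B ω)) =
      ((μ.map A).prod (μ.map B)).map (Prod.map id g) := by
    rw [← Measure.map_prod_map _ _ measurable_id hg, Measure.map_id, Measure.map_map hg hB]; rfl
  rw [mutualInfo, mutualInfo, hjoint, hprod, klDiv_map_of_leftInverse (f := Prod.map id g)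
    (g := Prod.map id g') (by fun_prop) (by fun_prop) fun p => Prod.ext rfl (h p.2)]

lemma condMutualInfo_comp_right [StandardBorelSpace α] [Nonempty α] [StandardBorelSpace β]
    [Nonempty β] [StandardBorelSpace β'] [Nonempty β'] (μ : Measure Ω) [IsFiniteMeasure μ]
    {C : Ω → γ} (hA : Measurable A) (hB : Measurable B) (hC : Measurable C) (hg : Measurable g)
    (hg' : Measurable g') (h : Function.LeftInverse g' g) :
    condMutualInfo μ A (fun ω => g (B ω)) C = condMutualInfo μ A B C := by
  refine (ENNReal.mul_left_inj ofReal_log_two_ne_zero ENNReal.ofReal_ne_top).1 ?_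
  have hD : Measurable fun ω => (C ω, B ω) := by fun_prop
  rw [condMutualInfo_mul_log_two μ hA hD (f := Prod.fst) (h := Prod.snd) (g := id)
      measurable_fst measurable_snd measurable_id fun _ => rfl]
  exact condMutualInfo_mul_log_two μ hA hD (f := Prod.fst) (h := fun d => g d.2)
    (g := Prod.map id g') measurable_fst (by fun_prop) (by fun_prop) fun d => Prod.ext rfl (h d.2)

lemma measure_eq_of_subsingleton [Subsingleton α] (μ ν : Measure α) [IsProbabilityMeasure μ]
    [IsProbabilityMeasure ν] : μ = ν := by
  ext s
  induction s using Subsingleton.set_cases <;> simp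

lemma condMutualInfo_eq_zero_of_subsingleton [StandardBorelSpace α] [Nonempty α]
    [StandardBorelSpace β] [Nonempty β] [Subsingleton α] [Subsingleton β] (μ : Measure Ω)
    [IsFiniteMeasure μ] {C : Ω → γ} (hA : Measurable A) (hB : Measurable B) :
    condMutualInfo μ A B C = 0 := by
  have h : condDistrib A C μ ×ₖ condDistrib B C μ = condDistrib (fun ω => (A ω, B ω)) C μ := by
    ext1 c
    exact measure_eq_of_subsingleton _ _
  rw [condMutualInfo, h, ← compProd_map_condDistrib (hA.prodMk hB).aemeasurable, klDiv_self,
    ENNReal.zero_div]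

end Transport

section TrivialUser

variable {X₁ X₂ Y₁ Y₂ : Type*}
  [MeasurableSpace X₁] [MeasurableSpace X₂] [MeasurableSpace Y₁] [MeasurableSpace Y₂]

instance (W : Kernel (X₁ × X₂) (Y₁ × Y₂)) [IsMarkovKernel W] :
    IsMarkovKernel (addTrivialUser W) :=
  Kernel.IsMarkovKernel.map _ (by fun_prop)

lemma fst_addTrivialUser (W : Kernel (X₁ × X₂) (Y₁ × Y₂)) (x : X₁ × X₂ × Unit) :
    (addTrivialUser W).fst x = W.fst (x.1, x.2.1) := by
  rw [addTrivialUser, Kernel.fst_apply, Kernel.map_apply _ (by fun_prop), Kernel.comap_apply,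
    Kernel.fst_apply, Measure.map_map (by fun_prop) (by fun_prop)]
  rfl

lemma snd_fst_addTrivialUser (W : Kernel (X₁ × X₂) (Y₁ × Y₂)) (x : X₁ × X₂ × Unit) :
    (addTrivialUser W).snd.fst x = W.snd (x.1, x.2.1) := by
  rw [addTrivialUser, Kernel.fst_apply, Kernel.snd_apply, Kernel.map_apply _ (by fun_prop),
    Kernel.comap_apply, Kernel.snd_apply, Measure.map_map (by fun_prop) (by fun_prop),
    Measure.map_map (by fun_prop) (by fun_prop)]
  rfl

lemma sameMarginals_addTrivialUser_iff (W V : Kernel (X₁ × X₂) (Y₁ × Y₂)) [IsMarkovKernel W]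
    [IsMarkovKernel V] :
    SameMarginals (addTrivialUser W) (addTrivialUser V) ↔ V.fst = W.fst ∧ V.snd = W.snd := by
  constructor
  · rintro ⟨h₁, h₂, -⟩
    constructor <;> ext1 x
    · rw [← fst_addTrivialUser V (x.1, x.2, ()), h₁, fst_addTrivialUser]
    · rw [← snd_fst_addTrivialUser V (x.1, x.2, ()), h₂, snd_fst_addTrivialUser]
  · rintro ⟨h₁, h₂⟩
    refine ⟨?_, ?_, ?_⟩ <;> ext1 x
    · rw [fst_addTrivialUser, fst_addTrivialUser, h₁]
    · rw [snd_fst_addTrivialUser, snd_fst_addTrivialUser, h₂]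
    · exact measure_eq_of_subsingleton _ _

lemma exists_addTrivialUser_eq (V : Kernel (X₁ × X₂ × Unit) (Y₁ × Y₂ × Unit)) [IsMarkovKernel V] :
    ∃ V₂ : Kernel (X₁ × X₂) (Y₁ × Y₂), IsMarkovKernel V₂ ∧ addTrivialUser V₂ = V := by
  refine ⟨(V.comap (fun x : X₁ × X₂ => (x.1, x.2, ())) (by fun_prop)).map
    (fun y => (y.1, y.2.1)), Kernel.IsMarkovKernel.map _ (by fun_prop), ?_⟩
  ext1 x
  rw [addTrivialUser, Kernel.map_apply _ (by fun_prop), Kernel.comap_apply,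
    Kernel.map_apply _ (by fun_prop), Kernel.comap_apply,
    Measure.map_map (by fun_prop) (by fun_prop)]
  exact Measure.map_id

/-- A two-user input law regarded as a three-user input law with a one-point third alphabet. -/
def addTrivialInput (P : Measure (X₁ × X₂)) : Measure (X₁ × X₂ × Unit) :=
  P.map fun x => (x.1, x.2, ())

instance (P : Measure (X₁ × X₂)) [IsProbabilityMeasure P] :
    IsProbabilityMeasure (addTrivialInput P) :=
  Measure.isProbabilityMeasure_map (by fun_prop)

lemma exists_addTrivialInput_eq (P : Measure (X₁ × X₂ × Unit)) [IsProbabilityMeasure P] :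
    ∃ P₂ : Measure (X₁ × X₂), IsProbabilityMeasure P₂ ∧ addTrivialInput P₂ = P := by
  refine ⟨P.map fun x => (x.1, x.2.1), Measure.isProbabilityMeasure_map (by fun_prop), ?_⟩
  rw [addTrivialInput, Measure.map_map (by fun_prop) (by fun_prop)]
  exact Measure.map_id

variable (P : Measure (X₁ × X₂)) [IsProbabilityMeasure P] (V : Kernel (X₁ × X₂) (Y₁ × Y₂))
  [IsMarkovKernel V]

lemma addTrivialInput_compProd_addTrivialUser :
    addTrivialInput P ⊗ₘ addTrivialUser V =
      (P ⊗ₘ V).map fun ω => ((ω.1.1, ω.1.2, ()), (ω.2.1, ω.2.2, ())) := by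
  ext s hs
  rw [Measure.map_apply (by fun_prop) hs, Measure.compProd_apply hs, addTrivialInput,
    Measure.compProd_apply (hs.preimage (by fun_prop)),
    lintegral_map (Kernel.measurable_kernel_prodMk_left hs) (by fun_prop)]
  refine lintegral_congr fun x => ?_
  rw [addTrivialUser, Kernel.map_apply _ (by fun_prop), Kernel.comap_apply,
    Measure.map_apply (by fun_prop) (measurable_prodMk_left hs)]
  rfl

lemma mutualInfo_addTrivialUser :
    mutualInfo (addTrivialInput P ⊗ₘ addTrivialUser V) (fun ω => ω.2.1) (fun ω => ω.1) =
      mutualInfo (P ⊗ₘ V) (fun ω => ω.2.1) (fun ω => ω.1) := by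
  rw [addTrivialInput_compProd_addTrivialUser,
    mutualInfo_map _ (by fun_prop) (by fun_prop) (by fun_prop)]
  exact mutualInfo_comp_right _ (B := Prod.fst) (g := fun x : X₁ × X₂ => (x.1, x.2, ()))
    (g' := fun x => (x.1, x.2.1)) (by fun_prop) (by fun_prop) (by fun_prop) (by fun_prop)
    fun _ => rfl

variable [StandardBorelSpace X₂] [Nonempty X₂] [StandardBorelSpace Y₂] [Nonempty Y₂]

lemma condMutualInfo_addTrivialUser {γ : Type*} [MeasurableSpace γ]
    {C : (X₁ × X₂ × Unit) × (Y₁ × Y₂ × Unit) → γ} (hC : Measurable C) :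
    condMutualInfo (addTrivialInput P ⊗ₘ addTrivialUser V) (fun ω => ω.2.2.1) (fun ω => ω.1.2) C =
      condMutualInfo (P ⊗ₘ V) (fun ω => ω.2.2) (fun ω => ω.1.2)
        (fun ω => C ((ω.1.1, ω.1.2, ()), (ω.2.1, ω.2.2, ()))) := by
  simp only [addTrivialInput_compProd_addTrivialUser]
  rw [condMutualInfo_map _ (by fun_prop) (by fun_prop) (by fun_prop) hC]
  exact condMutualInfo_comp_right _ (g := fun x => (x, ())) (g' := Prod.fst) (by fun_prop)
    (by fun_prop) (by fun_prop) (by fun_prop) (by fun_prop) fun _ => rfl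

lemma rateBounds_addTrivialUser_iff (R₁ R₂ : ℝ) :
    RateBounds (addTrivialInput P) (addTrivialUser V) (R₁, R₂, 0) ↔
      ENNReal.ofReal R₁ ≤ mutualInfo (P ⊗ₘ V) (fun ω => ω.2.1) (fun ω => ω.1) ∧
      ENNReal.ofReal R₂ ≤
        condMutualInfo (P ⊗ₘ V) (fun ω => ω.2.2) (fun ω => ω.1.2) (fun ω => ω.1.1) ∧
      ENNReal.ofReal (R₁ + R₂) ≤
        mutualInfo (P ⊗ₘ V) (fun ω => ω.2.1) (fun ω => ω.1) +
        condMutualInfo (P ⊗ₘ V) (fun ω => ω.2.2) (fun ω => ω.1.2) (fun ω => (ω.1.1, ω.2.1)) := by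
  have hI₁ := mutualInfo_addTrivialUser P V
  have hI₂ := condMutualInfo_addTrivialUser P V (C := fun ω => ω.1.1) (by fun_prop)
  have hI₂' := condMutualInfo_addTrivialUser P V (C := fun ω => (ω.1.1, ω.2.1)) (by fun_prop)
  have hI₃ : condMutualInfo (addTrivialInput P ⊗ₘ addTrivialUser V) (fun ω => ω.2.2.2)
      (fun ω => ω.1.2.2) (fun ω => (ω.1.1, ω.2.1, ω.1.2.1, ω.2.2.1)) = 0 :=
    condMutualInfo_eq_zero_of_subsingleton _ (by fun_prop) (by fun_prop)
  constructor
  · intro h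
    have hsum := h.rate₁₂₃
    rw [hI₁, hI₂', hI₃, add_zero, add_zero] at hsum
    exact ⟨hI₁ ▸ h.rate₁, hI₂ ▸ h.rate₂, hsum⟩
  · rintro ⟨h₁, h₂, hsum⟩
    refine ⟨hI₁ ▸ h₁, hI₂ ▸ h₂, by simp, ?_, ?_⟩
    · rw [hI₂, add_zero]
      exact h₂.trans le_self_add
    · rwa [hI₁, hI₂', hI₃, add_zero, add_zero]

theorem mem_outerRegion_addTrivialUser_iff (W : Kernel (X₁ × X₂) (Y₁ × Y₂)) [IsMarkovKernel W]
    (R₁ R₂ : ℝ) :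
    (R₁, R₂, (0 : ℝ)) ∈ outerRegion (addTrivialUser W) ↔ (R₁, R₂) ∈ twoUserOuterRegion W := by
  constructor
  · rintro ⟨P', hP', h⟩
    obtain ⟨P, hP, rfl⟩ := exists_addTrivialInput_eq P'
    refine ⟨P, hP, fun V _ h₁ h₂ => ?_⟩
    exact (rateBounds_addTrivialUser_iff P V R₁ R₂).1
      (h _ inferInstance ((sameMarginals_addTrivialUser_iff W V).2 ⟨h₁, h₂⟩))
  · rintro ⟨P, hP, h⟩
    refine ⟨addTrivialInput P, inferInstance, fun V' hV' hVW => ?_⟩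
    obtain ⟨V, hV, rfl⟩ := exists_addTrivialUser_eq V'
    obtain ⟨h₁, h₂⟩ := (sameMarginals_addTrivialUser_iff W V).1 hVW
    exact (rateBounds_addTrivialUser_iff P V R₁ R₂).2 (h V hV h₁ h₂)

end TrivialUser

end CIFC

end

theorem mainTheorem2_general {X₁ X₂ X₃ Y₁ Y₂ Y₃ : Type*}
    [MeasurableSpace X₁]
    [MeasurableSpace X₂] [StandardBorelSpace X₂] [Nonempty X₂]
    [MeasurableSpace X₃] [StandardBorelSpace X₃] [Nonempty X₃]
    [MeasurableSpace Y₁] [MeasurableSpace.CountablyGenerated Y₁]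
    [MeasurableSpace Y₂] [StandardBorelSpace Y₂] [Nonempty Y₂]
    [MeasurableSpace Y₃] [StandardBorelSpace Y₃] [Nonempty Y₃]
    (W : Kernel (X₁ × X₂ × X₃) (Y₁ × Y₂ × Y₃)) [IsMarkovKernel W] :
    CIFC.capacityRegion W ⊆ closure (CIFC.outerRegion W) ∧
    (MeasurableSingletonClass X₁ → Finite X₁ → Finite X₂ → Finite X₃ →
      CIFC.capacityRegion W ⊆ CIFC.outerRegion W) ∧
    (∀ (W₂ : Kernel (X₁ × X₂) (Y₁ × Y₂)) [IsMarkovKernel W₂] (R₁ R₂ : ℝ),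
      (R₁, R₂, (0 : ℝ)) ∈ CIFC.outerRegion (CIFC.addTrivialUser W₂) ↔
        (R₁, R₂) ∈ CIFC.twoUserOuterRegion W₂) :=
  ⟨CIFC.capacityRegion_subset_closure_outerRegion W,
    fun _ _ _ _ => CIFC.capacityRegion_subset_outerRegion W,
    fun W₂ _ R₁ R₂ => CIFC.mem_outerRegion_addTrivialUser_iff W₂ R₁ R₂⟩

theorem mainTheorem2 {X₁ X₂ X₃ Y₁ Y₂ Y₃ : Type*}
    [MeasurableSpace X₁] [StandardBorelSpace X₁] [Nonempty X₁]
    [MeasurableSpace X₂] [StandardBorelSpace X₂] [Nonempty X₂]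
    [MeasurableSpace X₃] [StandardBorelSpace X₃] [Nonempty X₃]
    [MeasurableSpace Y₁] [StandardBorelSpace Y₁] [Nonempty Y₁]
    [MeasurableSpace Y₂] [StandardBorelSpace Y₂] [Nonempty Y₂]
    [MeasurableSpace Y₃] [StandardBorelSpace Y₃] [Nonempty Y₃]
    (W : Kernel (X₁ × X₂ × X₃) (Y₁ × Y₂ × Y₃)) [IsMarkovKernel W] :
    CIFC.capacityRegion W ⊆ closure (CIFC.outerRegion W) ∧
    (Finite X₁ → Finite X₂ → Finite X₃ → CIFC.capacityRegion W ⊆ CIFC.outerRegion W) ∧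
    (∀ (W₂ : Kernel (X₁ × X₂) (Y₁ × Y₂)) [IsMarkovKernel W₂] (R₁ R₂ : ℝ),
      (R₁, R₂, (0 : ℝ)) ∈ CIFC.outerRegion (CIFC.addTrivialUser W₂) ↔
        (R₁, R₂) ∈ CIFC.twoUserOuterRegion W₂) := by
  obtain ⟨hclosure, hfinite, htwo⟩ := mainTheorem2_general W
  exact ⟨hclosure, hfinite inferInstance, htwo⟩
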